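/- **Setting.** Let $n\ge 2$ and let $\mathbf S^{n-1}\subset\mathbf R^n$ be the unit sphere with angular distance $\mathrm{dist}$. Let $N=(0,\dots,0,1)$ be the North pole, $S_+=\{x\in\mathbf S^{n-1}:x_n\ge 0\}$, and $E=\{x\in\mathbf S^{n-1}:x_n=0\}\cong\mathbf S^{n-2}$ the equator; let $\Pi_n:S_+\setminus\{N\}\to E$ be the projection along meridians. A $\varphi$-code is a subset of the sphere whose distinct points have pairwise distance at least $\varphi$. Let $A(n,\varphi)$ be the maximal size of a $\varphi$-code in $\mathbf S^{n-1}$, and $A(n,\varphi,\psi)$ the maximal size of a $\varphi$-code contained in a spherical cap of $\mathbf S^{n-1}$ of angular radius $\psi$. A kissing arrangement in $\Delta\subset\mathbf S^{n-1}$ is a $60^\circ$-code contained in $\Delta$. Put $$\omega(\varphi,\alpha,\beta)=\arccos\frac{\cos\varphi-\cos\alpha\cos\beta}{\sin\alpha\sin\beta}.$$ Let $60^\circ<\theta_0<90^\circ$, $0\le\theta\le\theta_0$ and $e_0\in E$. Define - $\psi_0=\omega(60^\circ,\theta_0,90^\circ)=\arccos\frac1{2\sin\theta_0}$ and $\rho(\theta)=\omega(60^\circ,\theta,90^\circ)=\arccos\frac1{2\sin\theta}$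 (for $\theta>30^\circ$); - $\gamma=\gamma(\theta,\theta_0)$ as the solution $\gamma\in[\theta,180^\circ]$ of $\cos 60^\circ=\cos\theta\cos\gamma+\sin\theta\sin\gamma\cos\psi_0$ (that is, of $\omega(60^\circ,\theta,\gamma)=\psi_0$), and $d(\theta,\theta_0)=\omega(60^\circ,\gamma(\theta,\theta_0),90^\circ)$; - $\theta_*=\theta_*(\theta_0)$ as the solution $t\in[0,\theta_0]$ of $d(t,\theta_0)=\psi_0$; - $\rho_5(\theta,\theta_0)$ as the solution $r\in[0,\psi_0]$ of $\cos d=\cos\psi_0\cos r+\sin\psi_0\sin r\cos\eta$, where $d=d(\theta,\theta_0)$ and $\eta=180^\circ-\tfrac32\,\omega(d,\psi_0,\psi_0)$. Let $\Lambda_n(\theta_0)$ be the spherical cone of all points of $S_+$ whose meridian meets the cap $\{q\in E:\mathrm{dist}(e_0,q)\le\psi_0\}$ (together with $N$). Let $c$ be the point at distance $\theta$ from $N$ on the meridian $Ne_0$, and let $\Delta_n(\theta,\theta_0)$ be the part of $\Lambda_n(\theta_0)$ lying below the sphere $S(c,60^\circ)$ of center $c$ and angular radius $60^\circ$: the points $x$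 with $\mathrm{dist}(c,x)\ge 60^\circ$ such that the meridian arc from $N$ to $x$ contains a point at distance less than $60^\circ$ from $c$. Let $\mu(n,\theta,\theta_0)$ be the maximal size of a kissing arrangement in $\Delta_n(\theta,\theta_0)$. **Theorem 6.** The equations defining $\gamma(\theta,\theta_0)$ and $\theta_*(\theta_0)$ have exactly one solution in the stated intervals. Let $X=\{p_1,\dots,p_m\}$ ($m$ distinct points) be a kissing arrangement in $\Delta_n(\theta,\theta_0)$ and let $q_i=\Pi_n(p_i)$. Then 1. $\mathrm{dist}(q_i,q_j)\ge d(\theta,\theta_0)$ for $i\ne j$, and $\mathrm{dist}(e_0,q_i)\ge\rho(\theta)$ for all $i$ if $\theta>30^\circ$; 2. $m\le\mu(n,\theta,\theta_0)\le A(n-1,d(\theta,\theta_0),\psi_0)$; 3. if $n\ge 3$ and $\theta>\theta_*(\theta_0)$, then $m\le\mu(n,\theta,\theta_0)\le A(n-2,\omega(d(\theta,\theta_0),\psi_0,\psi_0))$; 4. if $n=4$, then $m\le\mu(4,\theta,\theta_0)\le 6$; moreover, for $\theta>\theta_*(\theta_0)$ we have $m\le 5$, and if $m=5$, then the equation defining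 $\rho_5(\theta,\theta_0)$ has exactly one solution in $[0,\psi_0]$ and $\mathrm{dist}(e_0,q_i)\ge\rho_5(\theta,\theta_0)$ for all $i$. -/

import Mathlib

open scoped Real

noncomputable section

namespace OneSidedKissing

open InnerProductGeometry

/-- Euclidean space `ℝⁿ`. -/
abbrev Space (n : ℕ) := EuclideanSpace ℝ (Fin n)

/-- The unit sphere `S^{n-1}` in `ℝⁿ` (empty for `n = 0`). The spherical distance between two of its
points is the angle between them (`InnerProductGeometry.angle`, in radians). -/
def sph (n : ℕ) : Set (Space n) := Metric.sphere 0 1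

/-- The North pole `N = (0, …, 0, 1)`. -/
def north (n : ℕ) : Space n := WithLp.toLp 2 (fun i : Fin n => if (i : ℕ) + 1 = n then 1 else 0)

/-- The last coordinate `x_n`. -/
def height {n : ℕ} (x : Space n) : ℝ := inner ℝ (north n) x

/-- The closed upper hemisphere `S₊`. -/
def hemisphere (n : ℕ) : Set (Space n) := {x | x ∈ sph n ∧ 0 ≤ height x}

/-- The equator `E`, a copy of `S^{n-2}`. -/
def equator (n : ℕ) : Set (Space n) := {x | x ∈ sph n ∧ height x = 0}

/-- The projection `Π_n` from the pole along meridians to the equator: drop the last coordinate and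
normalize. It is meant for points of `S₊` other than the North pole. -/
def proj {n : ℕ} (x : Space n) : Space n :=
  ‖x - height x • north n‖⁻¹ • (x - height x • north n)

/-- The point at distance `s` from the North pole on the meridian that meets the equator in `q`. -/
def onMeridian {n : ℕ} (s : ℝ) (q : Space n) : Space n :=
  Real.cos s • north n + Real.sin s • q

/-- `C` is a `φ`-code in `S^{n-1}`. -/
def IsCode {n : ℕ} (φ : ℝ) (C : Set (Space n)) : Prop :=
  C ⊆ sph n ∧ C.Pairwise fun x y => φ ≤ angle x y

/-- `A(n, φ)`: the maximal size of a `φ`-code in `S^{n-1}`. -/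
def codeMax (n : ℕ) (φ : ℝ) : ℕ∞ :=
  ⨆ C ∈ {C : Set (Space n) | IsCode φ C}, C.encard

/-- The spherical cap in `S^{n-1}` of center `c` and angular radius `ψ`. -/
def cap {n : ℕ} (c : Space n) (ψ : ℝ) : Set (Space n) := {x | x ∈ sph n ∧ angle c x ≤ ψ}

/-- `A(n, φ, ψ)`: the maximal size of a `φ`-code in a spherical cap of `S^{n-1}` of angular
radius `ψ`. -/
def capCodeMax (n : ℕ) (φ ψ : ℝ) : ℕ∞ :=
  ⨆ C ∈ {C : Set (Space n) | IsCode φ C ∧ ∃ c ∈ sph n, C ⊆ cap c ψ}, C.encard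

/-- `P` is a kissing arrangement in `Δ`: a `60°`-code contained in `Δ`. -/
def IsKissingIn {n : ℕ} (Δ P : Set (Space n)) : Prop := P ⊆ Δ ∧ IsCode (π / 3) P

/-- `ω(φ, α, β)`, given by `cos ω = (cos φ - cos α cos β) / (sin α sin β)`. -/
def omega (φ α β : ℝ) : ℝ :=
  Real.arccos ((Real.cos φ - Real.cos α * Real.cos β) / (Real.sin α * Real.sin β))

/-- `ψ₀ = ω(60°, θ₀, 90°)`. -/
def psi0 (θ₀ : ℝ) : ℝ := omega (π / 3) θ₀ (π / 2)

/-- `ρ(θ) = ω(60°, θ, 90°)`. -/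
def rho (θ : ℝ) : ℝ := omega (π / 3) θ (π / 2)

/-- `x = |AB|` for a spherical triangle `ABC` with `|AC| = θ`, `|BC| = φ`, `∠BAC = ψ`. This is the
equation `ω(φ, θ, x) = ψ` with the denominator `sin θ sin x` cleared. -/
def IsSide (θ φ ψ x : ℝ) : Prop :=
  Real.cos φ = Real.cos θ * Real.cos x + Real.sin θ * Real.sin x * Real.cos ψ

/-- `γ₁(θ, φ, ψ)`: the solution `x` of the triangle equation with `x ≥ θ`. -/
def gammaOne (θ φ ψ : ℝ) : ℝ := sInf {x | x ∈ Set.Icc θ π ∧ IsSide θ φ ψ x}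

/-- `γ₂(θ, φ, ψ)`: the other solution `x` of the triangle equation, with `x ≤ θ`. -/
def gammaTwo (θ φ ψ : ℝ) : ℝ := sInf {x | x ∈ Set.Icc 0 θ ∧ IsSide θ φ ψ x}

/-- `γ(θ, θ₀) = γ₁(θ, 60°, ψ₀)`. -/
def gamma (θ θ₀ : ℝ) : ℝ := gammaOne θ (π / 3) (psi0 θ₀)

/-- `d(θ, θ₀) = ω(60°, γ(θ, θ₀), 90°)`. -/
def dd (θ θ₀ : ℝ) : ℝ := omega (π / 3) (gamma θ θ₀) (π / 2)

/-- `θ_*(θ₀)`: the solution `t ∈ [0, θ₀]` of `d(t, θ₀) = ψ₀`. -/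
def thetaStar (θ₀ : ℝ) : ℝ := sInf {t | t ∈ Set.Icc 0 θ₀ ∧ dd t θ₀ = psi0 θ₀}

/-- `η = 180° - (3/2) ω(d(θ, θ₀), ψ₀, ψ₀)`. -/
def eta (θ θ₀ : ℝ) : ℝ := π - 3 * omega (dd θ θ₀) (psi0 θ₀) (psi0 θ₀) / 2

/-- `ρ₅(θ, θ₀) = γ₂(ψ₀, d(θ, θ₀), η)`. -/
def rho5 (θ θ₀ : ℝ) : ℝ := gammaTwo (psi0 θ₀) (dd θ θ₀) (eta θ θ₀)

/-- The spherical cone `Λ_n(θ₀)` with vertex `N` and base the cap `C(e₀, ψ₀)` of the equator: the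
points of `S₊` whose meridian meets the base, and `N` itself. -/
def Lam (n : ℕ) (e₀ : Space n) (θ₀ : ℝ) : Set (Space n) :=
  {x | x ∈ hemisphere n ∧ (x = north n ∨ angle e₀ (proj x) ≤ psi0 θ₀)}

/-- `x` lies below the sphere `S(c, 60°)`: it is not inside this sphere, and on the way from `N` to
`x` along the meridian one passes through its inside. (The second condition only matters when `N` is
not inside the sphere; it discards the points above the sphere.) -/
def Below {n : ℕ} (c x : Space n) : Prop :=
  π / 3 ≤ angle c x ∧
    ∃ s ∈ Set.Icc 0 (angle (north n) x), angle c (onMeridian s (proj x)) < π / 3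

/-- The domain `Δ_n(θ, θ₀)`: the part of `Λ_n(θ₀)` below the sphere `S(c, 60°)`, where `c` is the
point of the height `N e₀` at distance `θ` from `N`. -/
def Delta (n : ℕ) (e₀ : Space n) (θ θ₀ : ℝ) : Set (Space n) :=
  {x | x ∈ Lam n e₀ θ₀ ∧ Below (onMeridian θ e₀) x}

/-- `μ(n, θ, θ₀)`: the maximal size of a kissing arrangement in `Δ_n(θ, θ₀)`. -/
def mu (n : ℕ) (e₀ : Space n) (θ θ₀ : ℝ) : ℕ∞ :=
  ⨆ X ∈ {X : Set (Space n) | IsKissingIn (Delta n e₀ θ θ₀) X}, X.encard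

end OneSidedKissing

end

open OneSidedKissing

namespace OneSidedKissing

open InnerProductGeometry Set

/-! The common tool is the concavity of `A cos x + B sin x` on `[0°, 90°]` for `A, B ≥ 0`. Along a
meridian whose angle with `N e₀` has cosine `k ≥ 0`, the cosine of the distance to `c` is such a
function, so the part of a quarter meridian inside `S(c, 60°)` is an arc. This locates the roots `γ`
and `θ_*`, confines `Δ` to polar distances in `[γ, 90°]`, and gives the bound `ρ`.

For two points on fixed meridians the law of cosines is concave in each polar distance separately,
so a lower bound on a square of polar distances follows from its corners. Projection from a pole
thereby turns separation of points into separation of directions (`inner_meridianProj_le`). This is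
applied twice. From `N`, the points of `Δ` go to points of the equatorial cap at mutual distance at
least `d` (`inner_proj_le`). From `e₀`, when `θ > θ_*` and hence `d > ψ₀`, these go to directions at
mutual angle at least `ω(d, ψ₀, ψ₀) > 60°` (`IsBaseCode.directions_of_nontrivial`), a code one
dimension lower.

For `n = 4` the directions lie on a circle, which holds at most five of them. For general `θ` a
small disc around `e₀` holds at most one point and the directions of the others are still more than
`60°` apart, so the bound is six. Among five directions each has another within `η`; a point too
close to `e₀` would then be closer than `d` to that neighbor, which gives `ρ₅`. -/

/-! ### Concavity of `A cos x + B sin x` -/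

theorem concaveOn_cos_add_sin {A B : ℝ} (hA : 0 ≤ A) (hB : 0 ≤ B) :
    ConcaveOn ℝ (Icc 0 (π / 2)) fun x => A * Real.cos x + B * Real.sin x := by
  have hc : ConcaveOn ℝ (Icc 0 (π / 2)) Real.cos :=
    strictConcaveOn_cos_Icc.concaveOn.subset
      (Icc_subset_Icc (by linarith [Real.pi_pos]) le_rfl) (convex_Icc _ _)
  have hs : ConcaveOn ℝ (Icc 0 (π / 2)) Real.sin :=
    strictConcaveOn_sin_Icc.concaveOn.subset
      (Icc_subset_Icc le_rfl (by linarith [Real.pi_pos])) (convex_Icc _ _)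
  exact (hc.smul hA).add (hs.smul hB)

/-- A concave function is above `c` between two points where it is above `c`; strictness at one
end is inherited away from the other end. -/
theorem lt_of_mem_Ico_of_concaveOn {f : ℝ → ℝ} {s : Set ℝ} (hf : ConcaveOn ℝ s f) {a b x c : ℝ}
    (ha : a ∈ s) (hb : b ∈ s) (hx : x ∈ Ico a b) (hca : c < f a) (hcb : c ≤ f b) : c < f x := by
  have hab : 0 < b - a := by linarith [hx.1, hx.2]
  have h := hf.2 ha hb
    (div_nonneg (by linarith [hx.2]) hab.le : 0 ≤ (b - x) / (b - a))
    (div_nonneg (by linarith [hx.1]) hab.le : 0 ≤ (x - a) / (b - a))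
    (by field_simp; ring)
  simp only [smul_eq_mul] at h
  have hx' : (b - x) / (b - a) * a + (x - a) / (b - a) * b = x := by field_simp; ring
  rw [hx'] at h
  have h1 : 0 < (b - x) / (b - a) := div_pos (by linarith [hx.2]) hab
  have h2 : 0 ≤ (x - a) / (b - a) := div_nonneg (by linarith [hx.1]) hab.le
  have h3 : (b - x) / (b - a) + (x - a) / (b - a) = 1 := by field_simp; ring
  have h4 : c = (b - x) / (b - a) * c + (x - a) / (b - a) * c := by rw [← add_mul, h3, one_mul]
  linarith [mul_lt_mul_of_pos_left hca h1, mul_le_mul_of_nonneg_left hcb h2]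

theorem lt_of_mem_Ioc_of_concaveOn {f : ℝ → ℝ} {s : Set ℝ} (hf : ConcaveOn ℝ s f) {a b x c : ℝ}
    (ha : a ∈ s) (hb : b ∈ s) (hx : x ∈ Ioc a b) (hca : c ≤ f a) (hcb : c < f b) : c < f x := by
  have hab : 0 < b - a := by linarith [hx.1, hx.2]
  have h := hf.2 ha hb
    (div_nonneg (by linarith [hx.2]) hab.le : 0 ≤ (b - x) / (b - a))
    (div_nonneg (by linarith [hx.1]) hab.le : 0 ≤ (x - a) / (b - a))
    (by field_simp; ring)
  simp only [smul_eq_mul] at h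
  have hx' : (b - x) / (b - a) * a + (x - a) / (b - a) * b = x := by field_simp; ring
  rw [hx'] at h
  have h1 : 0 ≤ (b - x) / (b - a) := div_nonneg (by linarith [hx.2]) hab.le
  have h2 : 0 < (x - a) / (b - a) := div_pos (by linarith [hx.1]) hab
  have h3 : (b - x) / (b - a) + (x - a) / (b - a) = 1 := by field_simp; ring
  have h4 : c = (b - x) / (b - a) * c + (x - a) / (b - a) * c := by rw [← add_mul, h3, one_mul]
  linarith [mul_le_mul_of_nonneg_left hca h1, mul_lt_mul_of_pos_left hcb h2]

theorem le_of_mem_Icc_of_concaveOn {f : ℝ → ℝ} {s : Set ℝ} (hf : ConcaveOn ℝ s f) {a b x c : ℝ}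
    (ha : a ∈ s) (hb : b ∈ s) (hx : x ∈ Icc a b) (hca : c ≤ f a) (hcb : c ≤ f b) : c ≤ f x :=
  (le_min hca hcb).trans (hf.min_le_of_mem_Icc ha hb hx)

/-- Lower bound for `cos a cos b + K sin a sin b` on a square from its values at the corners. -/
theorem le_cos_mul_cos_add_of_corners {K l u a b c : ℝ} (hK : 0 ≤ K) (hl : 0 ≤ l) (hu : u ≤ π / 2)
    (ha : a ∈ Icc l u) (hb : b ∈ Icc l u)
    (hll : c ≤ Real.cos l * Real.cos l + Real.sin l * Real.sin l * K)
    (hlu : c ≤ Real.cos l * Real.cos u + Real.sin l * Real.sin u * K)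
    (huu : c ≤ Real.cos u * Real.cos u + Real.sin u * Real.sin u * K) :
    c ≤ Real.cos a * Real.cos b + Real.sin a * Real.sin b * K := by
  have hlu' : l ≤ u := ha.1.trans ha.2
  have hpi := Real.pi_pos
  have hcos : ∀ x ∈ Icc l u, 0 ≤ Real.cos x := fun x hx =>
    Real.cos_nonneg_of_mem_Icc ⟨by linarith [hx.1], by linarith [hx.2]⟩
  have hsin : ∀ x ∈ Icc l u, 0 ≤ Real.sin x := fun x hx =>
    Real.sin_nonneg_of_nonneg_of_le_pi (by linarith [hx.1]) (by linarith [hx.2])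
  -- With `y` fixed the expression is concave in `x`. This is used on the edges `y = l` and `y = u`,
  -- and then on the segment `y = a` that joins them.
  have key : ∀ y ∈ Icc l u, c ≤ Real.cos y * Real.cos l + Real.sin y * Real.sin l * K →
      c ≤ Real.cos y * Real.cos u + Real.sin y * Real.sin u * K →
      ∀ x ∈ Icc l u, c ≤ Real.cos y * Real.cos x + Real.sin y * Real.sin x * K := by
    intro y hy h1 h2 x hx
    have := le_of_mem_Icc_of_concaveOn (c := c)
      (concaveOn_cos_add_sin (hcos y hy) (mul_nonneg (hsin y hy) hK))
      (a := l) (b := u) ⟨hl, by linarith⟩ ⟨by linarith, hu⟩ hx (by linarith) (by linarith)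
    linarith
  have hlm : l ∈ Icc l u := ⟨le_rfl, hlu'⟩
  have hum : u ∈ Icc l u := ⟨hlu', le_rfl⟩
  refine key a ha ?_ ?_ b hb
  · have := key l hlm hll hlu a ha
    linarith
  · have := key u hum (by linarith) huu a ha
    linarith

/-! ### Projection along the meridians of a pole -/

section Projection

variable {V : Type*} [NormedAddCommGroup V] [InnerProductSpace ℝ V]

/-- The projection from the pole `e` along meridians to the equator orthogonal to `e`. -/
noncomputable def meridianProj (e x : V) : V :=
  ‖x - (inner ℝ e x : ℝ) • e‖⁻¹ • (x - (inner ℝ e x : ℝ) • e)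

theorem cos_angle_of_norm_one {x y : V} (hx : ‖x‖ = 1) (hy : ‖y‖ = 1) :
    Real.cos (angle x y) = inner ℝ x y := by
  rw [cos_angle, hx, hy]; simp

theorem angle_eq_arccos_of_norm_one {x y : V} (hx : ‖x‖ = 1) (hy : ‖y‖ = 1) :
    angle x y = Real.arccos (inner ℝ x y) := by
  rw [angle, hx, hy]; simp

theorem norm_sub_inner_smul {e x : V} (he : ‖e‖ = 1) (hx : ‖x‖ = 1) :
    ‖x - (inner ℝ e x : ℝ) • e‖ = Real.sin (angle e x) := by
  have h1 : ‖x - (inner ℝ e x : ℝ) • e‖ ^ 2 = Real.sin (angle e x) ^ 2 := by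
    rw [Real.sin_sq, cos_angle_of_norm_one he hx, norm_sub_sq_real, norm_smul, he, hx,
      inner_smul_right, real_inner_comm, mul_one, Real.norm_eq_abs, sq_abs]
    ring
  exact (sq_eq_sq₀ (norm_nonneg _) (sin_angle_nonneg e x)).1 h1

theorem eq_cos_smul_add_sin_smul {e x : V} (he : ‖e‖ = 1) (hx : ‖x‖ = 1) :
    x = Real.cos (angle e x) • e + Real.sin (angle e x) • meridianProj e x := by
  rw [meridianProj, cos_angle_of_norm_one he hx, ← norm_sub_inner_smul he hx]
  -- At `x = ±e` the projection takes the default value `0`, and its coefficient vanishes anyway.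
  by_cases h : ‖x - (inner ℝ e x : ℝ) • e‖ = 0
  · rw [h, zero_smul, add_zero]
    exact sub_eq_zero.1 (norm_eq_zero.1 h)
  · rw [smul_smul, mul_inv_cancel₀ h, one_smul]
    abel

theorem norm_meridianProj {e x : V} (he : ‖e‖ = 1) (hx : ‖x‖ = 1)
    (h : 0 < Real.sin (angle e x)) : ‖meridianProj e x‖ = 1 := by
  rw [meridianProj, norm_smul, norm_inv, norm_norm, norm_sub_inner_smul he hx,
    inv_mul_cancel₀ h.ne']

theorem inner_meridianProj_self {e : V} (he : ‖e‖ = 1) (x : V) :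
    inner ℝ e (meridianProj e x) = 0 := by
  rw [meridianProj, inner_smul_right, inner_sub_right, inner_smul_right,
    real_inner_self_eq_norm_sq, he]
  simp

theorem inner_meridianProj_of_orthogonal {e f x : V} (hef : inner ℝ f e = 0)
    (hfx : inner ℝ f x = 0) : inner ℝ f (meridianProj e x) = 0 := by
  rw [meridianProj, inner_smul_right, inner_sub_right, inner_smul_right, hef, hfx]
  simp

/-- The spherical law of cosines in the triangle `e x y`. -/
theorem inner_eq_cos_mul_cos_add {e x y : V} (he : ‖e‖ = 1) (hx : ‖x‖ = 1) (hy : ‖y‖ = 1) :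
    inner ℝ x y = Real.cos (angle e x) * Real.cos (angle e y) +
      Real.sin (angle e x) * Real.sin (angle e y) *
        inner ℝ (meridianProj e x) (meridianProj e y) := by
  conv_lhs => rw [eq_cos_smul_add_sin_smul he hx, eq_cos_smul_add_sin_smul he hy]
  have h1 := inner_meridianProj_self he x
  have h2 := inner_meridianProj_self he y
  rw [real_inner_comm] at h1
  simp only [inner_add_left, inner_add_right, inner_smul_left, inner_smul_right, h1, h2,
    real_inner_self_eq_norm_sq, he, RCLike.conj_to_real]
  ring

/-- By the law of cosines, two points whose directions at `e` make an angle with cosine above `K`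
would have inner product above `c`; the corner conditions guarantee this for all polar distances in
`[l, u]`. -/
theorem inner_meridianProj_le {e x y : V} (he : ‖e‖ = 1) (hx : ‖x‖ = 1) (hy : ‖y‖ = 1)
    {K l u c : ℝ} (hK : 0 ≤ K) (hl : 0 ≤ l) (hu : u ≤ π / 2)
    (hxa : angle e x ∈ Icc l u) (hya : angle e y ∈ Icc l u)
    (hx0 : 0 < angle e x) (hy0 : 0 < angle e y)
    (hll : c ≤ Real.cos l * Real.cos l + Real.sin l * Real.sin l * K)
    (hlu : c ≤ Real.cos l * Real.cos u + Real.sin l * Real.sin u * K)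
    (huu : c ≤ Real.cos u * Real.cos u + Real.sin u * Real.sin u * K)
    (hxy : inner ℝ x y ≤ c) :
    inner ℝ (meridianProj e x) (meridianProj e y) ≤ K := by
  have hpi := Real.pi_pos
  have h := le_cos_mul_cos_add_of_corners hK hl hu hxa hya hll hlu huu
  rw [inner_eq_cos_mul_cos_add he hx hy] at hxy
  have hsx := Real.sin_pos_of_pos_of_lt_pi hx0 (by linarith [hxa.2])
  have hsy := Real.sin_pos_of_pos_of_lt_pi hy0 (by linarith [hya.2])
  have := mul_pos hsx hsy
  exact le_of_mul_le_mul_left (by linarith) this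

end Projection

/-! ### Points on a great circle -/

/-- More than `k` reals in an interval of length `k L` cannot have all distances at least `L`. -/
theorem card_le_of_pairwise_le_abs_sub {ι : Type*} {s : Finset ι} {t : ι → ℝ} {a L : ℝ} {k : ℕ}
    (hL : 0 < L) (ht : ∀ i ∈ s, t i ∈ Ico a (a + k * L))
    (hs : ∀ i ∈ s, ∀ j ∈ s, i ≠ j → L ≤ |t i - t j|) : s.card ≤ k := by
  by_contra! hk
  -- Pigeonhole over the `k` half-open subintervals of length `L`.
  obtain ⟨i, hi, j, hj, hij, h⟩ := Finset.exists_ne_map_eq_of_card_lt_of_maps_to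
    (s := s) (t := Finset.range k) (f := fun i => ⌊(t i - a) / L⌋₊) (by simpa using hk) (by
      intro i hi
      have := ht i hi
      simp only [Finset.coe_range, mem_Iio]
      rw [Nat.floor_lt (div_nonneg (by linarith [this.1]) hL.le), div_lt_iff₀ hL]
      linarith [this.2])
  have hL' := hs i hi j hj hij
  have key : ∀ i ∈ s, (⌊(t i - a) / L⌋₊ : ℝ) * L ≤ t i - a ∧
      t i - a < (⌊(t i - a) / L⌋₊ + 1) * L := fun i hi =>
    ⟨(le_div_iff₀ hL).1 (Nat.floor_le (div_nonneg (by linarith [(ht i hi).1]) hL.le)),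
      (div_lt_iff₀ hL).1 (Nat.lt_floor_add_one _)⟩
  have hi' := key i hi
  have hj' := key j hj
  rw [h] at hi'
  have : |t i - t j| < L := by
    rw [abs_lt]
    constructor <;> nlinarith [hi'.1, hi'.2, hj'.1, hj'.2]
  linarith

theorem exists_cos_sin_eq {a b : ℝ} (h : a ^ 2 + b ^ 2 = 1) :
    ∃ t ∈ Ico 0 (2 * π), Real.cos t = a ∧ Real.sin t = b := by
  set z : ℂ := ⟨a, b⟩
  have hz : ‖z‖ = 1 := by
    rw [Complex.norm_def, Complex.normSq_apply, Real.sqrt_eq_one]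
    simp only [z]; linarith
  have hz0 : z ≠ 0 := by intro h0; simp [h0] at hz
  have hc : Real.cos z.arg = a := by rw [Complex.cos_arg hz0, hz]; simp [z]
  have hs : Real.sin z.arg = b := by rw [Complex.sin_arg, hz]; simp [z]
  have := Complex.arg_mem_Ioc z
  have hpi := Real.pi_pos
  rcases le_or_gt 0 z.arg with h0 | h0
  · exact ⟨z.arg, ⟨h0, by linarith [this.2]⟩, hc, hs⟩
  · exact ⟨z.arg + 2 * π, ⟨by linarith [this.1], by linarith⟩, by rw [Real.cos_add_two_pi, hc],
      by rw [Real.sin_add_two_pi, hs]⟩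

theorem exists_inner_preserving {n k : ℕ} (V : Submodule ℝ (Space n))
    (hV : Module.finrank ℝ V = k) :
    ∃ f : Space n → Space k, ∀ x ∈ V, ∀ y ∈ V, inner ℝ (f x) (f y) = (inner ℝ x y : ℝ) := by
  classical
  let b := (stdOrthonormalBasis ℝ V).reindex (finCongr hV)
  refine ⟨fun x => if h : x ∈ V then b.repr ⟨x, h⟩ else 0, fun x hx y hy => ?_⟩
  simp only [hx, hy, dif_pos]
  rw [LinearIsometryEquiv.inner_map_map]
  rfl

/-- Polar angle on a great circle, measured from a point `u`. -/
theorem exists_polar_angle {n : ℕ} (V : Submodule ℝ (Space n)) (hV : Module.finrank ℝ V = 2)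
    {u : Space n} (hu : u ∈ V) (hu1 : ‖u‖ = 1) :
    ∃ t : Space n → ℝ, (∀ x ∈ V, ‖x‖ = 1 → t x ∈ Ico 0 (2 * π) ∧ inner ℝ u x = Real.cos (t x)) ∧
      ∀ x ∈ V, ‖x‖ = 1 → ∀ y ∈ V, ‖y‖ = 1 → inner ℝ x y = Real.cos (t x - t y) := by
  obtain ⟨f, hf⟩ := exists_inner_preserving V hV
  have hin : ∀ x ∈ V, ∀ y ∈ V, (inner ℝ x y : ℝ) = f x 0 * f y 0 + f x 1 * f y 1 := by
    intro x hx y hy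
    rw [← hf x hx y hy, PiLp.inner_apply, Fin.sum_univ_two]
    simp [mul_comm]
  have hnorm : ∀ x ∈ V, ‖x‖ = 1 → f x 0 * f x 0 + f x 1 * f x 1 = 1 := by
    intro x hx h
    rw [← hin x hx x hx, real_inner_self_eq_norm_sq, h, one_pow]
  have hu2 := hnorm u hu hu1
  -- In complex notation the prescribed cosine and sine are the real and imaginary parts of `conj (f
  -- u) * f x`.
  have key : ∀ x : Space n, ∃ t : ℝ, x ∈ V → ‖x‖ = 1 → t ∈ Ico 0 (2 * π) ∧
      Real.cos t = f u 0 * f x 0 + f u 1 * f x 1 ∧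
      Real.sin t = f u 0 * f x 1 - f u 1 * f x 0 := by
    intro x
    by_cases hx : x ∈ V ∧ ‖x‖ = 1
    · obtain ⟨t, ht, h1, h2⟩ := exists_cos_sin_eq (a := f u 0 * f x 0 + f u 1 * f x 1)
        (b := f u 0 * f x 1 - f u 1 * f x 0) (by
          have := hnorm x hx.1 hx.2
          calc _ = (f u 0 * f u 0 + f u 1 * f u 1) * (f x 0 * f x 0 + f x 1 * f x 1) := by ring
            _ = 1 := by rw [hu2, this, one_mul])
      exact ⟨t, fun _ _ => ⟨ht, h1, h2⟩⟩
    · exact ⟨0, fun h1 h2 => absurd ⟨h1, h2⟩ hx⟩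
  choose t ht using key
  refine ⟨t, fun x hx hx1 => ⟨(ht x hx hx1).1, ?_⟩, fun x hx hx1 y hy hy1 => ?_⟩
  · rw [(ht x hx hx1).2.1, hin u hu x hx]
  · rw [Real.cos_sub, (ht x hx hx1).2.1, (ht x hx hx1).2.2, (ht y hy hy1).2.1,
      (ht y hy hy1).2.2, hin x hx y hy]
    linear_combination (-(f x 0 * f y 0 + f x 1 * f y 1)) * hu2

/-- On a great circle, at most `k` points with mutual distances at least `ω` are farther than `β`
from a given point if `2 (π - β) ≤ k ω`. -/
theorem card_le_of_far {n : ℕ} (V : Submodule ℝ (Space n)) (hV : Module.finrank ℝ V = 2)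
    {u : Space n} (hu : u ∈ V) (hu1 : ‖u‖ = 1) {s : Finset (Space n)} {ω β : ℝ} {k : ℕ}
    (hω : 0 < ω) (hωπ : ω ≤ π) (hβπ : β ≤ π) (hk : 2 * (π - β) ≤ k * ω)
    (hsV : ∀ x ∈ s, x ∈ V ∧ ‖x‖ = 1) (hsu : ∀ x ∈ s, inner ℝ u x < Real.cos β)
    (hs : ∀ x ∈ s, ∀ y ∈ s, x ≠ y → inner ℝ x y ≤ Real.cos ω) : s.card ≤ k := by
  obtain ⟨t, ht, htt⟩ := exists_polar_angle V hV hu hu1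
  -- The polar angles measured from `u` lie strictly between `β` and `2π - β`, an interval of length
  -- at most `k ω`.
  refine card_le_of_pairwise_le_abs_sub (t := t) (a := β) hω (fun x hx => ?_)
    fun x hx y hy hxy => ?_
  · have h := ht x (hsV x hx).1 (hsV x hx).2
    have h1 := hsu x hx
    rw [h.2] at h1
    constructor
    · by_contra! hlt
      exact absurd (Real.cos_le_cos_of_nonneg_of_le_pi h.1.1 hβπ hlt.le) (not_le.2 h1)
    · by_contra! hlt
      rw [← Real.cos_two_pi_sub] at h1
      exact absurd (Real.cos_le_cos_of_nonneg_of_le_pi (by linarith [h.1.2]) hβπ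
        (by linarith : 2 * π - t x ≤ β)) (not_le.2 h1)
  · have h1 := hs x hx y hy hxy
    rw [htt x (hsV x hx).1 (hsV x hx).2 y (hsV y hy).1 (hsV y hy).2, ← Real.cos_abs] at h1
    by_contra! hlt
    exact absurd (Real.cos_lt_cos_of_nonneg_of_le_pi (abs_nonneg _) hωπ hlt) (not_lt.2 h1)

/-- Since `arccos K > 60°`, all points other than a chosen `u` lie on the arc of length `240°`
farther than `60°` from `u`, which has room for at most four. -/
theorem card_le_five {n : ℕ} (V : Submodule ℝ (Space n)) (hV : Module.finrank ℝ V = 2)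
    {S : Set (Space n)} {K : ℝ} (hK : 0 ≤ K) (hK2 : K < 1 / 2) (hSV : ∀ x ∈ S, x ∈ V ∧ ‖x‖ = 1)
    (hS : ∀ x ∈ S, ∀ y ∈ S, x ≠ y → inner ℝ x y ≤ K) : S.encard ≤ 5 := by
  classical
  by_contra! hlt
  -- Passing to a six-point subset also covers infinite `S`.
  obtain ⟨T, hTS, hT⟩ := Set.exists_subset_encard_eq (s := S) (k := 6)
    (Order.add_one_le_of_lt hlt)
  obtain ⟨s, rfl⟩ : ∃ s : Finset (Space n), (s : Set (Space n)) = T :=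
    (Set.finite_of_encard_eq_coe (k := 6) (by simpa using hT)).exists_finset_coe
  have hs6 : s.card = 6 := by
    rw [Set.encard_coe_eq_coe_finsetCard] at hT
    exact_mod_cast hT
  obtain ⟨u, hu⟩ := Finset.card_pos.1 (by omega : 0 < s.card)
  have hpi := Real.pi_pos
  have hKω : Real.cos (Real.arccos K) = K := Real.cos_arccos (by linarith) (by linarith)
  have hω : π / 3 < Real.arccos K := by
    by_contra! h
    have := Real.cos_le_cos_of_nonneg_of_le_pi (Real.arccos_nonneg K) (by linarith) h
    rw [hKω, Real.cos_pi_div_three] at this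
    linarith
  have := card_le_of_far V hV (hSV u (hTS hu)).1 (hSV u (hTS hu)).2 (s := s.erase u)
    (ω := Real.arccos K) (β := π / 3) (k := 4) (by linarith) (Real.arccos_le_pi K)
    (by linarith) (by push_cast; linarith)
    (fun x hx => hSV x (hTS (Finset.mem_of_mem_erase hx)))
    (fun x hx => by
      rw [Real.cos_pi_div_three]
      exact (hS u (hTS hu) x (hTS (Finset.mem_of_mem_erase hx))
        (Finset.ne_of_mem_erase hx).symm).trans_lt hK2)
    (fun x hx y hy hxy => by
      rw [hKω]
      exact hS x (hTS (Finset.mem_of_mem_erase hx)) y (hTS (Finset.mem_of_mem_erase hy)) hxy)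
  rw [Finset.card_erase_of_mem hu] at this
  omega

/-! ### Transfer of codes to lower-dimensional spheres -/

theorem finrank_orthogonal_span {n k : ℕ} {v : Fin k → Space n} (hv : Orthonormal ℝ v) :
    Module.finrank ℝ (Submodule.span ℝ (Set.range v))ᗮ = n - k := by
  have h1 := Submodule.finrank_add_finrank_orthogonal (Submodule.span ℝ (Set.range v))
  rw [finrank_span_eq_card hv.linearIndependent, finrank_euclideanSpace, Fintype.card_fin,
    Fintype.card_fin] at h1
  omega

theorem mem_orthogonal_span_range {n k : ℕ} {v : Fin k → Space n} {x : Space n}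
    (h : ∀ i, inner ℝ (v i) x = 0) : x ∈ (Submodule.span ℝ (Set.range v))ᗮ := by
  rw [Submodule.mem_orthogonal]
  intro u hu
  induction hu using Submodule.span_induction with
  | mem y hy => obtain ⟨i, rfl⟩ := hy; exact h i
  | zero => exact inner_zero_left _
  | add y z _ _ hy hz => rw [inner_add_left, hy, hz, add_zero]
  | smul a y _ hy => rw [inner_smul_left, hy, mul_zero]

theorem exists_angle_preserving {n k : ℕ} (V : Submodule ℝ (Space n))
    (hV : Module.finrank ℝ V = k) :
    ∃ f : Space n → Space k, (∀ x ∈ V, ‖f x‖ = ‖x‖) ∧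
      (∀ x ∈ V, ∀ y ∈ V, angle (f x) (f y) = angle x y) ∧ Set.InjOn f V := by
  obtain ⟨f, hf⟩ := exists_inner_preserving V hV
  have hn : ∀ x ∈ V, ‖f x‖ = ‖x‖ := fun x hx => by
    rw [← sq_eq_sq₀ (norm_nonneg _) (norm_nonneg _), ← real_inner_self_eq_norm_sq, hf x hx x hx,
      real_inner_self_eq_norm_sq]
  refine ⟨f, hn, fun x hx y hy => by rw [angle, angle, hf x hx y hy, hn x hx, hn y hy],
    fun x hx y hy hxy => ?_⟩
  have h1 : ‖x - y‖ ^ 2 = 0 := by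
    rw [norm_sub_sq_real, ← hf x hx y hy, hxy, real_inner_self_eq_norm_sq, ← hxy, hn x hx]
    have : ‖x‖ = ‖y‖ := by rw [← hn x hx, hxy, hn y hy]
    rw [this]; ring
  exact sub_eq_zero.1 (norm_eq_zero.1 (pow_eq_zero_iff two_ne_zero |>.1 h1))

theorem IsCode.image {n k : ℕ} {V : Submodule ℝ (Space n)} {f : Space n → Space k}
    (hf : ∀ x ∈ V, ‖f x‖ = ‖x‖) (hfa : ∀ x ∈ V, ∀ y ∈ V, angle (f x) (f y) = angle x y)
    {φ : ℝ} {S : Set (Space n)} (hS : IsCode φ S) (hSV : S ⊆ V) : IsCode φ (f '' S) := by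
  constructor
  · rintro _ ⟨x, hx, rfl⟩
    have := hS.1 hx
    simp only [sph, mem_sphere_zero_iff_norm] at this ⊢
    rw [hf x (hSV hx), this]
  · rintro _ ⟨x, hx, rfl⟩ _ ⟨y, hy, rfl⟩ hxy
    simp only [hfa x (hSV hx) y (hSV hy)]
    exact hS.2 hx hy fun h => hxy (by rw [h])

theorem encard_le_codeMax {n k : ℕ} (V : Submodule ℝ (Space n)) (hV : Module.finrank ℝ V = k)
    {φ : ℝ} {S : Set (Space n)} (hS : IsCode φ S) (hSV : S ⊆ V) : S.encard ≤ codeMax k φ := by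
  obtain ⟨f, hf, hfa, hfi⟩ := exists_angle_preserving V hV
  rw [← (hfi.mono hSV).encard_image]
  exact le_iSup₂ (f := fun (C : Set (Space k)) (_ : C ∈ {C | IsCode φ C}) => C.encard) _
    (hS.image hf hfa hSV)

theorem encard_le_capCodeMax {n k : ℕ} (V : Submodule ℝ (Space n)) (hV : Module.finrank ℝ V = k)
    {φ ψ : ℝ} {S : Set (Space n)} (hS : IsCode φ S) (hSV : S ⊆ V) {c : Space n} (hc : c ∈ sph n)
    (hcV : c ∈ V) (hSc : S ⊆ cap c ψ) : S.encard ≤ capCodeMax k φ ψ := by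
  obtain ⟨f, hf, hfa, hfi⟩ := exists_angle_preserving V hV
  rw [← (hfi.mono hSV).encard_image]
  have hC := hS.image hf hfa hSV
  refine le_iSup₂ (f := fun (C : Set (Space k))
    (_ : C ∈ {C | IsCode φ C ∧ ∃ c ∈ sph k, C ⊆ cap c ψ}) => C.encard) _ ⟨hC, f c, ?_, ?_⟩
  · simp only [sph, mem_sphere_zero_iff_norm] at hc ⊢
    rw [hf c hcV, hc]
  · rintro _ ⟨x, hx, rfl⟩
    refine ⟨hC.1 ⟨x, hx, rfl⟩, ?_⟩
    rw [hfa c hcV x (hSV hx)]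
    exact (hSc hx).2

/-! ### The angles `ψ₀`, `γ`, `d`, `θ_*` -/

theorem omega_pi_div_two (α : ℝ) :
    omega (π / 3) α (π / 2) = Real.arccos (1 / (2 * Real.sin α)) := by
  rw [omega, Real.cos_pi_div_two, Real.cos_pi_div_three, Real.sin_pi_div_two]
  congr 1
  rw [mul_zero, sub_zero, mul_one, div_div]

theorem sin_mem_of_mem_Icc {α : ℝ} (hα : α ∈ Icc (π / 3) (π / 2)) :
    √3 / 2 ≤ Real.sin α ∧ Real.sin α ≤ 1 := by
  refine ⟨?_, Real.sin_le_one _⟩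
  rw [← Real.sin_pi_div_three]
  exact Real.sin_le_sin_of_le_of_le_pi_div_two (by linarith [Real.pi_pos]) hα.2 hα.1

/-- For `60° ≤ α ≤ 90°`, `cos ω(60°, α, 90°) = 1 / (2 sin α)` lies in `[1/2, 1/√3]`. -/
theorem cos_omega_pi_div_two {α : ℝ} (hα : α ∈ Icc (π / 3) (π / 2)) :
    Real.cos (omega (π / 3) α (π / 2)) = 1 / (2 * Real.sin α) ∧
    2 * Real.sin α * Real.cos (omega (π / 3) α (π / 2)) = 1 ∧
    1 / 2 ≤ Real.cos (omega (π / 3) α (π / 2)) ∧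
    3 * Real.cos (omega (π / 3) α (π / 2)) ^ 2 ≤ 1 := by
  obtain ⟨h1, h2⟩ := sin_mem_of_mem_Icc hα
  have h3 : √3 ^ 2 = 3 := Real.sq_sqrt (by norm_num)
  have h4 : 0 < √3 := by positivity
  have hs : 0 < Real.sin α := by linarith
  have hk : 2 * Real.sin α * (1 / (2 * Real.sin α)) = 1 := by field_simp
  set k := 1 / (2 * Real.sin α)
  have hk0 : 0 < k := by positivity
  have hk1 : 1 / 2 ≤ k := by nlinarith
  have hk2 : √3 * k ≤ 1 := by nlinarith
  have hk3 : 3 * k ^ 2 ≤ 1 := by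
    calc 3 * k ^ 2 = (√3 * k) ^ 2 := by rw [mul_pow, h3]
      _ ≤ 1 := by rw [sq_le_one_iff₀ (by positivity)]; exact hk2
  have hkk : Real.cos (omega (π / 3) α (π / 2)) = k := by
    rw [omega_pi_div_two, Real.cos_arccos (by linarith) (by nlinarith)]
  rw [hkk]
  exact ⟨rfl, hk, hk1, hk3⟩

section Angles

variable {θ θ₀ : ℝ}

theorem psi0_props (hθ₀ : π / 3 < θ₀) (hθ₀' : θ₀ < π / 2) :
    2 * Real.sin θ₀ * Real.cos (psi0 θ₀) = 1 ∧ 1 / 2 < Real.cos (psi0 θ₀) ∧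
      3 * Real.cos (psi0 θ₀) ^ 2 ≤ 1 ∧ 0 < psi0 θ₀ ∧ psi0 θ₀ < π / 3 := by
  have hpi := Real.pi_pos
  obtain ⟨-, h1, h2, h3⟩ := cos_omega_pi_div_two (α := θ₀) ⟨hθ₀.le, hθ₀'.le⟩
  change 2 * Real.sin θ₀ * Real.cos (psi0 θ₀) = 1 at h1
  change 1 / 2 ≤ Real.cos (psi0 θ₀) at h2
  change 3 * Real.cos (psi0 θ₀) ^ 2 ≤ 1 at h3
  have hs : Real.sin θ₀ < 1 := by
    rw [← Real.sin_pi_div_two]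
    exact Real.sin_lt_sin_of_lt_of_le_pi_div_two (by linarith) le_rfl hθ₀'
  have h4 : 1 / 2 < Real.cos (psi0 θ₀) := by nlinarith
  have h0 : 0 ≤ psi0 θ₀ := Real.arccos_nonneg _
  refine ⟨h1, h4, h3, h0.lt_of_ne fun h => ?_, ?_⟩
  · rw [← h, Real.cos_zero] at h3
    norm_num at h3
  · by_contra! h
    have := Real.cos_le_cos_of_nonneg_of_le_pi (by linarith) (y := psi0 θ₀)
      (Real.arccos_le_pi _) h
    rw [Real.cos_pi_div_three] at this
    linarith

/-- The cosine of the distance between the points at distances `θ` and `x` from the pole on two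
meridians whose angle has cosine `k`. -/
theorem concaveOn_side {k : ℝ} (hθ : 0 ≤ θ) (hθ' : θ ≤ π / 2) (hk : 0 ≤ k) :
    ConcaveOn ℝ (Icc 0 (π / 2))
      fun x => Real.cos θ * Real.cos x + Real.sin θ * k * Real.sin x :=
  concaveOn_cos_add_sin (Real.cos_nonneg_of_mem_Icc ⟨by linarith [Real.pi_pos], hθ'⟩)
    (mul_nonneg (Real.sin_nonneg_of_nonneg_of_le_pi hθ (by linarith [Real.pi_pos])) hk)

/-- The right side is a weighted mean of `1` and `k`. Geometrically, the point at polar distance `θ`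
on a meridian less than `60°` away from that of `c` lies inside `S(c, 60°)`; it serves as the
interior endpoint in the concavity arguments. -/
theorem half_lt_side_self {k : ℝ} (hk : 1 / 2 < k) :
    1 / 2 < Real.cos θ * Real.cos θ + Real.sin θ * k * Real.sin θ := by
  nlinarith [Real.sin_sq_add_cos_sq θ, sq_nonneg (Real.sin θ), sq_nonneg (Real.cos θ),
    mul_nonneg (sq_nonneg (Real.sin θ)) (sub_nonneg.2 hk.le)]

/-- The side function exceeds `1/2` at `θ` and is `sin θ cos ψ₀ ≤ sin θ₀ cos ψ₀ = 1/2` at `90°`, so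
a root exists. Past `90°` its cosine term is negative and no root is left. -/
theorem existsUnique_gamma (hθ₀ : π / 3 < θ₀) (hθ₀' : θ₀ < π / 2) (hθ : 0 ≤ θ) (hθ' : θ ≤ θ₀) :
    ∃! x, x ∈ Icc θ π ∧ IsSide θ (π / 3) (psi0 θ₀) x := by
  have hpi := Real.pi_pos
  obtain ⟨h1, h2, -, -, -⟩ := psi0_props hθ₀ hθ₀'
  set k := Real.cos (psi0 θ₀) with hkdef
  have hs0 : 0 ≤ Real.sin θ := Real.sin_nonneg_of_nonneg_of_le_pi hθ (by linarith)
  have hc0 : 0 < Real.cos θ := Real.cos_pos_of_mem_Ioo ⟨by linarith, by linarith⟩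
  have hsθ : Real.sin θ ≤ Real.sin θ₀ :=
    Real.sin_le_sin_of_le_of_le_pi_div_two (by linarith) hθ₀'.le hθ'
  have hsk : Real.sin θ * k ≤ 1 / 2 := by nlinarith
  set f : ℝ → ℝ := fun x => Real.cos θ * Real.cos x + Real.sin θ * k * Real.sin x with hf
  have hfc : ConcaveOn ℝ (Icc 0 (π / 2)) f := concaveOn_side hθ (by linarith) (by linarith)
  have hfθ : 1 / 2 < f θ := half_lt_side_self h2
  have hside : ∀ x, IsSide θ (π / 3) (psi0 θ₀) x ↔ f x = 1 / 2 := by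
    intro x
    rw [IsSide, Real.cos_pi_div_three, hf, ← hkdef]
    constructor <;> intro h <;> simp only at h ⊢ <;> linarith
  have hle : ∀ x, x ∈ Icc θ π → f x = 1 / 2 → x ≤ π / 2 := by
    intro x hx hfx
    by_contra! hlt
    have hcx : Real.cos x < 0 := Real.cos_neg_of_pi_div_two_lt_of_lt hlt (by linarith [hx.2])
    have := Real.sin_le_one x
    have h5 : 0 ≤ Real.sin x := Real.sin_nonneg_of_nonneg_of_le_pi (by linarith) hx.2
    have h6 := mul_neg_of_pos_of_neg hc0 hcx
    have h7 : Real.sin θ * k * Real.sin x ≤ 1 / 2 * 1 :=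
      mul_le_mul hsk this h5 (by norm_num)
    simp only [hf] at hfx
    linarith
  have hcont : ContinuousOn f (Icc θ (π / 2)) := by
    apply Continuous.continuousOn
    fun_prop
  obtain ⟨x, hx, hfx⟩ := intermediate_value_Icc' (by linarith : θ ≤ π / 2) hcont
    (show (1 / 2 : ℝ) ∈ Icc (f (π / 2)) (f θ) from ⟨by simpa [hf] using hsk, hfθ.le⟩)
  refine ⟨x, ⟨⟨hx.1, by linarith [hx.2]⟩, (hside x).2 hfx⟩, ?_⟩
  rintro y ⟨hy, hyf⟩
  rw [hside] at hyf
  have hy2 := hle y hy hyf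
  -- Above `1/2` at `θ` and equal to it at `b`, a concave function exceeds `1/2` everywhere in
  -- between, so it has no earlier root.
  have key : ∀ a b, θ ≤ a → a < b → b ≤ π / 2 → f a = 1 / 2 → f b = 1 / 2 → False := by
    intro a b ha hab hb hfa hfb
    have := lt_of_mem_Ico_of_concaveOn hfc (a := θ) (b := b) (x := a) (c := 1 / 2)
      ⟨hθ, by linarith⟩ ⟨by linarith, hb⟩ ⟨ha, hab⟩ hfθ hfb.ge
    linarith
  rcases lt_trichotomy x y with h | h | h
  · exact (key x y hx.1 h hy2 hfx hyf).elim
  · exact h.symm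
  · exact (key y x hy.1 h hx.2 hyf hfx).elim

theorem csInf_eq_of_existsUnique {s : Set ℝ} {a : ℝ} (h : ∃! x, x ∈ s) (ha : a ∈ s) :
    sInf s = a := by
  rw [show s = {a} from eq_singleton_iff_unique_mem.2 ⟨ha, fun x hx => h.unique hx ha⟩,
    csInf_singleton]

theorem gamma_eq_of_isSide (hθ₀ : π / 3 < θ₀) (hθ₀' : θ₀ < π / 2) (hθ : 0 ≤ θ) (hθ' : θ ≤ θ₀)
    {x : ℝ} (hx : x ∈ Icc θ π) (hs : IsSide θ (π / 3) (psi0 θ₀) x) : gamma θ θ₀ = x :=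
  csInf_eq_of_existsUnique (existsUnique_gamma hθ₀ hθ₀' hθ hθ') ⟨hx, hs⟩

theorem gamma_spec (hθ₀ : π / 3 < θ₀) (hθ₀' : θ₀ < π / 2) (hθ : 0 ≤ θ) (hθ' : θ ≤ θ₀) :
    θ ≤ gamma θ θ₀ ∧ gamma θ θ₀ ∈ Icc (π / 3) (π / 2) ∧
      Real.cos θ * Real.cos (gamma θ θ₀) +
        Real.sin θ * Real.cos (psi0 θ₀) * Real.sin (gamma θ θ₀) = 1 / 2 := by
  have hpi := Real.pi_pos
  obtain ⟨h1, h2, -, -, -⟩ := psi0_props hθ₀ hθ₀'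
  obtain ⟨g, ⟨hg, hgs⟩, -⟩ := existsUnique_gamma hθ₀ hθ₀' hθ hθ'
  rw [gamma_eq_of_isSide hθ₀ hθ₀' hθ hθ' hg hgs]
  have hgs' : Real.cos θ * Real.cos g + Real.sin θ * Real.cos (psi0 θ₀) * Real.sin g = 1 / 2 := by
    rw [IsSide, Real.cos_pi_div_three] at hgs
    linarith
  set k := Real.cos (psi0 θ₀) with hkdef
  have hs0 : 0 ≤ Real.sin θ := Real.sin_nonneg_of_nonneg_of_le_pi hθ (by linarith)
  have hc0 : 0 < Real.cos θ := Real.cos_pos_of_mem_Ioo ⟨by linarith, by linarith⟩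
  have hsθ : Real.sin θ ≤ Real.sin θ₀ :=
    Real.sin_le_sin_of_le_of_le_pi_div_two (by linarith) hθ₀'.le hθ'
  have hsk : Real.sin θ * k ≤ 1 / 2 := by nlinarith
  refine ⟨hg.1, ⟨?_, ?_⟩, hgs'⟩
  · by_contra! hlt
    have hfc := concaveOn_side (k := k) hθ (by linarith) (by linarith)
    have h3 : (√3 : ℝ) ^ 2 = 3 := Real.sq_sqrt (by norm_num)
    have hs3 : 0 < √3 := by positivity
    -- With `cos ψ₀ > 1/2` this puts the side function at `60°` at or above `1/2`. By concavity it
    -- then exceeds `1/2` on `[θ, 60°)`, so the root `γ` cannot lie there.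
    have h60 : 1 ≤ 1 * Real.cos θ + √3 / 2 * Real.sin θ := by
      refine le_of_mem_Icc_of_concaveOn (concaveOn_cos_add_sin (A := 1) (B := √3 / 2) (by norm_num)
        (by positivity)) (a := 0) (b := π / 3) ⟨le_rfl, by linarith⟩ ⟨by linarith, by linarith⟩
        ⟨hθ, by linarith [hg.1]⟩ (by simp) ?_
      rw [Real.cos_pi_div_three, Real.sin_pi_div_three]
      nlinarith
    have hk3 : √3 / 2 * (Real.sin θ * (1 / 2)) ≤ √3 / 2 * (Real.sin θ * k) :=
      mul_le_mul_of_nonneg_left (mul_le_mul_of_nonneg_left h2.le hs0) (by positivity)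
    have := lt_of_mem_Ico_of_concaveOn hfc (a := θ) (b := π / 3) (x := g) (c := 1 / 2)
      ⟨hθ, by linarith⟩ ⟨by linarith, by linarith⟩ ⟨hg.1, hlt⟩ (half_lt_side_self h2)
      (by simp only [Real.cos_pi_div_three, Real.sin_pi_div_three]; linarith)
    linarith
  · by_contra! hlt
    have hcx : Real.cos g < 0 := Real.cos_neg_of_pi_div_two_lt_of_lt hlt (by linarith [hg.2])
    have h5 : 0 ≤ Real.sin g := Real.sin_nonneg_of_nonneg_of_le_pi (by linarith) hg.2
    have h6 := mul_neg_of_pos_of_neg hc0 hcx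
    have h7 : Real.sin θ * k * Real.sin g ≤ 1 / 2 * 1 :=
      mul_le_mul hsk (Real.sin_le_one g) h5 (by norm_num)
    linarith

theorem dd_props (hθ₀ : π / 3 < θ₀) (hθ₀' : θ₀ < π / 2) (hθ : 0 ≤ θ) (hθ' : θ ≤ θ₀) :
    2 * Real.sin (gamma θ θ₀) * Real.cos (dd θ θ₀) = 1 ∧ 1 / 2 ≤ Real.cos (dd θ θ₀) ∧
      3 * Real.cos (dd θ θ₀) ^ 2 ≤ 1 ∧ dd θ θ₀ ∈ Icc 0 π :=
  have h := cos_omega_pi_div_two (gamma_spec hθ₀ hθ₀' hθ hθ').2.1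
  ⟨h.2.1, h.2.2.1, h.2.2.2, Real.arccos_nonneg _, Real.arccos_le_pi _⟩

/-- The equation `d(θ, θ₀) = ψ₀` amounts to `γ(θ, θ₀) = θ₀`, hence to a linear equation in `cos θ` and
`sin θ`. -/
theorem dd_eq_psi0_iff (hθ₀ : π / 3 < θ₀) (hθ₀' : θ₀ < π / 2) (hθ : 0 ≤ θ) (hθ' : θ ≤ θ₀) :
    dd θ θ₀ = psi0 θ₀ ↔ Real.cos θ₀ * Real.cos θ + 1 / 2 * Real.sin θ = 1 / 2 := by
  have hpi := Real.pi_pos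
  obtain ⟨h1, h2, -, -, -⟩ := psi0_props hθ₀ hθ₀'
  obtain ⟨g1, g2, g3⟩ := gamma_spec hθ₀ hθ₀' hθ hθ'
  obtain ⟨d1, d2, -, -⟩ := dd_props hθ₀ hθ₀' hθ hθ'
  constructor
  · intro h
    rw [h] at d1
    have hsin : Real.sin (gamma θ θ₀) = Real.sin θ₀ := by
      have : Real.cos (psi0 θ₀) ≠ 0 := by linarith
      apply mul_right_cancel₀ this
      linarith
    have hg : gamma θ θ₀ = θ₀ := Real.injOn_sin ⟨by linarith [g2.1], g2.2⟩
      ⟨by linarith, hθ₀'.le⟩ hsin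
    rw [hg] at g3
    linear_combination g3 - 1 / 2 * Real.sin θ * h1
  · intro h
    have hg : gamma θ θ₀ = θ₀ := gamma_eq_of_isSide hθ₀ hθ₀' hθ hθ' ⟨hθ', by linarith⟩ (by
      rw [IsSide, Real.cos_pi_div_three]
      linear_combination -h - 1 / 2 * Real.sin θ * h1)
    rw [dd, hg, psi0]

/-- With `s = sin θ₀`, the difference of the two sides is `(1 - s)(1/2 + s)`. -/
theorem half_lt_at_theta0 (hθ₀ : π / 3 < θ₀) (hθ₀' : θ₀ < π / 2) :
    1 / 2 < Real.cos θ₀ * Real.cos θ₀ + 1 / 2 * Real.sin θ₀ := by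
  have hpi := Real.pi_pos
  have h0 : 0 < Real.sin θ₀ := Real.sin_pos_of_pos_of_lt_pi (by linarith) (by linarith)
  have h1 : Real.sin θ₀ < 1 := by
    rw [← Real.sin_pi_div_two]
    exact Real.sin_lt_sin_of_lt_of_le_pi_div_two (by linarith) le_rfl hθ₀'
  nlinarith [Real.sin_sq_add_cos_sq θ₀]

theorem concaveOn_thetaStar (hθ₀ : π / 3 < θ₀) (hθ₀' : θ₀ < π / 2) :
    ConcaveOn ℝ (Icc 0 (π / 2)) fun t => Real.cos θ₀ * Real.cos t + 1 / 2 * Real.sin t :=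
  concaveOn_cos_add_sin
    (Real.cos_nonneg_of_mem_Icc ⟨by linarith [Real.pi_pos], hθ₀'.le⟩) (by norm_num)

/-- By `dd_eq_psi0_iff` this concerns a concave function of `t` that is at most `1/2` at `0` and
above `1/2` at `θ₀`; after its first root it stays above `1/2`. -/
theorem existsUnique_thetaStar (hθ₀ : π / 3 < θ₀) (hθ₀' : θ₀ < π / 2) :
    ∃! t, t ∈ Icc 0 θ₀ ∧ dd t θ₀ = psi0 θ₀ := by
  have hpi := Real.pi_pos
  have hfc := concaveOn_thetaStar hθ₀ hθ₀'
  have hfθ := half_lt_at_theta0 hθ₀ hθ₀'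
  set f : ℝ → ℝ := fun t => Real.cos θ₀ * Real.cos t + 1 / 2 * Real.sin t with hf
  have hf0 : f 0 ≤ 1 / 2 := by
    simp only [hf, Real.cos_zero, Real.sin_zero]
    rw [← Real.cos_pi_div_three]
    have := Real.cos_le_cos_of_nonneg_of_le_pi (by linarith : 0 ≤ π / 3) (by linarith) hθ₀.le
    linarith
  have hcont : ContinuousOn f (Icc 0 θ₀) := by
    apply Continuous.continuousOn
    fun_prop
  obtain ⟨x, hx, hfx⟩ := intermediate_value_Icc (by linarith : (0 : ℝ) ≤ θ₀) hcont
    (show (1 / 2 : ℝ) ∈ Icc (f 0) (f θ₀) from ⟨hf0, hfθ.le⟩)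
  refine ⟨x, ⟨hx, (dd_eq_psi0_iff hθ₀ hθ₀' hx.1 hx.2).2 hfx⟩, ?_⟩
  rintro y ⟨hy, hyd⟩
  have hfy : f y = 1 / 2 := (dd_eq_psi0_iff hθ₀ hθ₀' hy.1 hy.2).1 hyd
  have key : ∀ a b, 0 ≤ a → a < b → b ≤ θ₀ → f a = 1 / 2 → f b = 1 / 2 → False := by
    intro a b ha hab hb hfa hfb
    have := lt_of_mem_Ioc_of_concaveOn hfc (a := a) (b := θ₀) (x := b) (c := 1 / 2)
      ⟨ha, by linarith⟩ ⟨by linarith, hθ₀'.le⟩ ⟨hab, hb⟩ hfa.ge hfθ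
    linarith
  rcases lt_trichotomy x y with h | h | h
  · exact (key x y hx.1 h hy.2 hfx hfy).elim
  · exact h.symm
  · exact (key y x hy.1 h hx.2 hfy hfx).elim

/-- Past `θ_*` the point at polar distance `θ₀` on a meridian at angle `ψ₀` is still inside the
sphere, so `γ > θ₀`. As `cos d = 1 / (2 sin γ)` and `cos ψ₀ = 1 / (2 sin θ₀)`, this means `d > ψ₀`.
-/
theorem cos_dd_lt_cos_psi0 (hθ₀ : π / 3 < θ₀) (hθ₀' : θ₀ < π / 2) (hθ' : θ ≤ θ₀)
    (h : thetaStar θ₀ < θ) : Real.cos (dd θ θ₀) < Real.cos (psi0 θ₀) := by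
  have hpi := Real.pi_pos
  obtain ⟨t, ⟨ht, htd⟩, -⟩ := existsUnique_thetaStar hθ₀ hθ₀'
  have hts : thetaStar θ₀ = t :=
    csInf_eq_of_existsUnique (existsUnique_thetaStar hθ₀ hθ₀') ⟨ht, htd⟩
  rw [hts] at h
  have hθ : 0 ≤ θ := ht.1.trans h.le
  obtain ⟨h1, h2, -, -, -⟩ := psi0_props hθ₀ hθ₀'
  obtain ⟨g1, g2, g3⟩ := gamma_spec hθ₀ hθ₀' hθ hθ'
  obtain ⟨d1, d2, -, -⟩ := dd_props hθ₀ hθ₀' hθ hθ'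
  have hft := (dd_eq_psi0_iff hθ₀ hθ₀' ht.1 ht.2).1 htd
  have hL := lt_of_mem_Ioc_of_concaveOn (concaveOn_thetaStar hθ₀ hθ₀') (a := t) (b := θ₀) (x := θ)
    (c := 1 / 2) ⟨ht.1, by linarith [ht.2]⟩ ⟨by linarith, hθ₀'.le⟩ ⟨h, hθ'⟩ hft.ge
    (half_lt_at_theta0 hθ₀ hθ₀')
  have hg : θ₀ < gamma θ θ₀ := by
    by_contra! hle
    have hθ₀v : 1 / 2 < Real.cos θ * Real.cos θ₀ +
        Real.sin θ * Real.cos (psi0 θ₀) * Real.sin θ₀ := by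
      linear_combination hL - (1 / 2 * Real.sin θ) * h1
    have hne : θ ≠ gamma θ θ₀ := fun he => by
      have := half_lt_side_self (θ := θ) h2
      rw [← he] at g3
      linarith
    have := lt_of_mem_Ioc_of_concaveOn (concaveOn_side (k := Real.cos (psi0 θ₀)) hθ
      (by linarith) (by linarith)) (a := θ) (b := θ₀) (x := gamma θ θ₀) (c := 1 / 2)
      ⟨hθ, by linarith⟩ ⟨by linarith, by linarith⟩ ⟨g1.lt_of_ne hne, hle⟩
      (half_lt_side_self h2).le hθ₀v
    linarith
  have hsin : Real.sin θ₀ < Real.sin (gamma θ θ₀) :=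
    Real.sin_lt_sin_of_lt_of_le_pi_div_two (by linarith) g2.2 hg
  have hs0 : 0 < Real.sin θ₀ := Real.sin_pos_of_pos_of_lt_pi (by linarith) (by linarith)
  by_contra! hle
  have := mul_lt_mul hsin hle (by linarith) (by linarith)
  linarith

end Angles

/-! ### Points below the sphere -/

theorem norm_north {n : ℕ} (hn : 0 < n) : ‖north n‖ = 1 := by
  have : north n = PiLp.single 2 (⟨n - 1, by omega⟩ : Fin n) (1 : ℝ) := by
    ext i
    simp only [north, PiLp.single_apply, Fin.ext_iff]
    congr 1
    exact propext ⟨fun h => by omega, fun h => by omega⟩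
  rw [this, PiLp.norm_single, norm_one]

theorem proj_eq_meridianProj {n : ℕ} (x : Space n) : proj x = meridianProj (north n) x := rfl

theorem meridianProj_self {V : Type*} [NormedAddCommGroup V] [InnerProductSpace ℝ V] {e : V}
    (he : ‖e‖ = 1) : meridianProj e e = 0 := by
  rw [meridianProj, real_inner_self_eq_norm_sq, he]
  simp

theorem inner_onMeridian {n : ℕ} (hn : 0 < n) {q r : Space n} (hq : inner ℝ (north n) q = 0)
    (hr : inner ℝ (north n) r = 0) (s t : ℝ) :
    inner ℝ (onMeridian s q) (onMeridian t r) =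
      Real.cos s * Real.cos t + Real.sin s * inner ℝ q r * Real.sin t := by
  have hq' := hq
  rw [real_inner_comm] at hq'
  simp only [onMeridian, inner_add_left, inner_add_right, inner_smul_left, inner_smul_right, hq',
    hr, real_inner_self_eq_norm_sq, norm_north hn, RCLike.conj_to_real]
  ring

theorem norm_onMeridian {n : ℕ} (hn : 0 < n) {q : Space n} (hq : inner ℝ (north n) q = 0)
    (hq1 : ‖q‖ = 1) (s : ℝ) : ‖onMeridian s q‖ = 1 := by
  have h : ‖onMeridian s q‖ ^ 2 = 1 := by
    rw [← real_inner_self_eq_norm_sq, inner_onMeridian hn hq hq, real_inner_self_eq_norm_sq, hq1]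
    linear_combination Real.cos_sq_add_sin_sq s
  exact (pow_eq_one_iff_of_nonneg (norm_nonneg _) two_ne_zero).1 h

theorem pi_div_three_le_angle_iff {n : ℕ} {x y : Space n} (hx : ‖x‖ = 1) (hy : ‖y‖ = 1) :
    π / 3 ≤ angle x y ↔ inner ℝ x y ≤ 1 / 2 := by
  have hpi := Real.pi_pos
  rw [← cos_angle_of_norm_one hx hy, ← Real.cos_pi_div_three]
  exact (Real.strictAntiOn_cos.le_iff_ge ⟨angle_nonneg _ _, angle_le_pi _ _⟩
    ⟨by linarith, by linarith⟩).symm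

section Domain

variable {n : ℕ} {θ θ₀ : ℝ} {e₀ x y : Space n}

/-- The position of a point of the domain: it lies on a meridian over the base, at a distance in
`[γ, 90°]` from the pole, and outside the sphere. -/
theorem mem_Delta_props (hn : 2 ≤ n) (hθ₀ : π / 3 < θ₀) (hθ₀' : θ₀ < π / 2) (hθ : 0 ≤ θ)
    (hθ' : θ ≤ θ₀) (he₀ : e₀ ∈ equator n) (hx : x ∈ Delta n e₀ θ θ₀) :
    ‖x‖ = 1 ∧ angle (north n) x ∈ Icc (gamma θ θ₀) (π / 2) ∧ ‖proj x‖ = 1 ∧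
      inner ℝ (north n) (proj x) = 0 ∧ angle e₀ (proj x) ≤ psi0 θ₀ ∧
      Real.cos θ * Real.cos (angle (north n) x) +
        Real.sin θ * inner ℝ e₀ (proj x) * Real.sin (angle (north n) x) ≤ 1 / 2 := by
  have hpi := Real.pi_pos
  have hn0 : 0 < n := by omega
  have hN := norm_north hn0
  have he1 : ‖e₀‖ = 1 := by simpa [sph] using he₀.1
  have heN : inner ℝ (north n) e₀ = 0 := he₀.2
  obtain ⟨⟨⟨hx1, hxh⟩, hxm⟩, hxb, s, hs, hxs⟩ := hx
  have hx1 : ‖x‖ = 1 := by simpa [sph] using hx1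
  -- At the pole `proj` has the default value `0` and the arc reduces to `s = 0`, so `N` would be
  -- both inside the sphere and not inside it.
  have hxN : x ≠ north n := by
    rintro rfl
    rw [angle_self (by rintro h; simp [h] at hN), Icc_self, mem_singleton_iff] at hs
    rw [hs, proj_eq_meridianProj, meridianProj_self hN] at hxs
    simp only [onMeridian, Real.cos_zero, Real.sin_zero, one_smul, smul_zero, add_zero] at hxs hxb
    exact absurd hxs (not_lt.2 hxb)
  have hα : angle e₀ (proj x) ≤ psi0 θ₀ := hxm.resolve_left hxN
  set a := angle (north n) x with ha
  have ha0 : 0 < a := (angle_nonneg _ _).lt_of_ne fun h => hxN (by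
    rw [eq_cos_smul_add_sin_smul hN hx1, ← h]
    simp)
  have ha2 : a ≤ π / 2 := by
    rw [ha, angle_eq_arccos_of_norm_one hN hx1, Real.arccos_le_pi_div_two]
    exact hxh
  have hq1 : ‖proj x‖ = 1 := norm_meridianProj hN hx1 (Real.sin_pos_of_pos_of_lt_pi ha0
    (by linarith))
  have hqN : inner ℝ (north n) (proj x) = 0 := inner_meridianProj_self hN x
  have hxq : onMeridian a (proj x) = x := (eq_cos_smul_add_sin_smul hN hx1).symm
  have hc1 := norm_onMeridian hn0 heN he1 θ
  set k := (inner ℝ e₀ (proj x) : ℝ) with hk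
  obtain ⟨-, hψ, -, hψ0, hψ3⟩ := psi0_props hθ₀ hθ₀'
  have hkψ : Real.cos (psi0 θ₀) ≤ k := by
    rw [hk, ← cos_angle_of_norm_one he1 hq1]
    exact Real.cos_le_cos_of_nonneg_of_le_pi (angle_nonneg _ _) (by linarith) hα
  have hFa : Real.cos θ * Real.cos a + Real.sin θ * k * Real.sin a ≤ 1 / 2 := by
    have := (pi_div_three_le_angle_iff hc1 hx1).1 hxb
    rwa [← hxq, inner_onMeridian hn0 heN hqN] at this
  have hFs : 1 / 2 < Real.cos θ * Real.cos s + Real.sin θ * k * Real.sin s := by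
    have := (pi_div_three_le_angle_iff hc1 (norm_onMeridian hn0 hqN hq1 s)).not.1 (not_le.2 hxs)
    rwa [not_le, inner_onMeridian hn0 heN hqN] at this
  refine ⟨hx1, ⟨?_, ha2⟩, hq1, hqN, hα, hFa⟩
  obtain ⟨g1, g2, g3⟩ := gamma_spec hθ₀ hθ₀' hθ hθ'
  by_contra! hlt
  -- Suppose `a < γ`. If `a ≥ θ`, then `x` is inside the sphere because `[θ, γ)` is inside even on
  -- the extreme meridian at angle `ψ₀`. If `a ≤ θ`, then `x` lies between the interior point at `s`
  -- and the one at `θ`.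
  rcases le_total θ a with h | h
  · have h1 := lt_of_mem_Ico_of_concaveOn (concaveOn_side (k := Real.cos (psi0 θ₀)) hθ
      (by linarith) (by linarith)) (a := θ) (b := gamma θ θ₀) (x := a) (c := 1 / 2)
      ⟨hθ, by linarith⟩ ⟨by linarith, g2.2⟩ ⟨h, hlt⟩ (half_lt_side_self hψ) g3.ge
    have h2 : 0 ≤ Real.sin θ := Real.sin_nonneg_of_nonneg_of_le_pi hθ (by linarith)
    have h3 : 0 ≤ Real.sin a := Real.sin_nonneg_of_nonneg_of_le_pi ha0.le (by linarith)
    have := mul_le_mul_of_nonneg_left hkψ (mul_nonneg h2 h3)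
    linarith
  · have h1 := half_lt_side_self (θ := θ) (hψ.trans_le hkψ)
    have hc := concaveOn_side (θ := θ) (k := k) hθ (by linarith) (by linarith)
    rcases hs.2.eq_or_lt with h4 | h4
    · rw [h4] at hFs
      linarith
    · have := lt_of_mem_Ioc_of_concaveOn hc (a := s) (b := θ) (x := a) (c := 1 / 2)
        ⟨hs.1, by linarith [hs.2]⟩ ⟨hθ, by linarith⟩ ⟨h4, h⟩ hFs.le h1
      linarith

/-- If `q = proj x` were closer to `e₀` than `ρ(θ)`, the foot `q` of the meridian would be inside
the sphere. So would the point at polar distance `θ`, and with them everything between, including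
`x`. -/
theorem rho_le_angle (hn : 2 ≤ n) (hθ₀ : π / 3 < θ₀) (hθ₀' : θ₀ < π / 2)
    (hθ6 : π / 6 < θ) (hθ' : θ ≤ θ₀) (he₀ : e₀ ∈ equator n) (hx : x ∈ Delta n e₀ θ θ₀) :
    rho θ ≤ angle e₀ (proj x) := by
  have hpi := Real.pi_pos
  have hθ : 0 ≤ θ := by linarith
  have he1 : ‖e₀‖ = 1 := by simpa [sph] using he₀.1
  obtain ⟨hx1, ha, hq1, hqN, hα, hF⟩ := mem_Delta_props hn hθ₀ hθ₀' hθ hθ' he₀ hx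
  obtain ⟨g1, g2, -⟩ := gamma_spec hθ₀ hθ₀' hθ hθ'
  rw [rho, omega_pi_div_two, angle_eq_arccos_of_norm_one he1 hq1]
  apply Real.arccos_le_arccos
  set k := (inner ℝ e₀ (proj x) : ℝ) with hk
  have hs0 : 0 < Real.sin θ := Real.sin_pos_of_pos_of_lt_pi (by linarith) (by linarith)
  by_contra! hlt
  rw [div_lt_iff₀ (by positivity)] at hlt
  have hk2 : 1 / 2 < k := by
    nlinarith [Real.sin_le_one θ]
  have h2 : 1 / 2 < Real.cos θ * Real.cos (π / 2) + Real.sin θ * k * Real.sin (π / 2) := by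
    rw [Real.cos_pi_div_two, Real.sin_pi_div_two]
    linarith
  rcases ha.2.eq_or_lt with h | h
  · rw [h] at hF
    linarith
  · have := lt_of_mem_Ico_of_concaveOn (concaveOn_side (k := k) hθ (by linarith) (by linarith))
      (a := θ) (b := π / 2) (x := angle (north n) x) (c := 1 / 2) ⟨hθ, by linarith⟩
      ⟨by linarith, le_rfl⟩ ⟨by linarith [ha.1], h⟩ (half_lt_side_self hk2) h2.le
    linarith

theorem inner_proj_le (hn : 2 ≤ n) (hθ₀ : π / 3 < θ₀) (hθ₀' : θ₀ < π / 2) (hθ : 0 ≤ θ)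
    (hθ' : θ ≤ θ₀) (he₀ : e₀ ∈ equator n) (hx : x ∈ Delta n e₀ θ θ₀) (hy : y ∈ Delta n e₀ θ θ₀)
    (hxy : π / 3 ≤ angle x y) : inner ℝ (proj x) (proj y) ≤ Real.cos (dd θ θ₀) := by
  have hpi := Real.pi_pos
  obtain ⟨hx1, hxa, -, -, -, -⟩ := mem_Delta_props hn hθ₀ hθ₀' hθ hθ' he₀ hx
  obtain ⟨hy1, hya, -, -, -, -⟩ := mem_Delta_props hn hθ₀ hθ₀' hθ hθ' he₀ hy
  obtain ⟨g1, g2, -⟩ := gamma_spec hθ₀ hθ₀' hθ hθ'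
  obtain ⟨d1, d2, -, -⟩ := dd_props hθ₀ hθ₀' hθ hθ'
  have hsg : 0 < Real.sin (gamma θ θ₀) := Real.sin_pos_of_pos_of_lt_pi (by linarith [g2.1])
    (by linarith [g2.2])
  -- With `K = cos d = 1 / (2 sin γ)`, the corner `(γ, 90°)` is an equality. The corner `(γ, γ)`
  -- reduces to `(1 - sin γ)(1/2 + sin γ) ≥ 0`, and `(90°, 90°)` to `K ≥ 1/2`.
  refine inner_meridianProj_le (norm_north (by omega)) hx1 hy1 (l := gamma θ θ₀) (u := π / 2)
    (c := 1 / 2) (by linarith) (by linarith [g2.1]) le_rfl hxa hya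
    (by linarith [hxa.1, g2.1]) (by linarith [hya.1, g2.1]) ?_ ?_ ?_
    ((pi_div_three_le_angle_iff hx1 hy1).1 hxy)
  · nlinarith [Real.sin_sq_add_cos_sq (gamma θ θ₀), Real.sin_le_one (gamma θ θ₀)]
  · rw [Real.cos_pi_div_two, Real.sin_pi_div_two]
    linarith
  · rw [Real.cos_pi_div_two, Real.sin_pi_div_two]
    linarith

end Domain

/-! ### Codes in a cap, projected from the center of the cap -/

section CapCode

variable {n : ℕ} {θ θ₀ : ℝ} {e₀ : Space n}

/-- A set of points of the equator with the properties of the projection of a kissing arrangement in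
`Δ`: a subset of the cap of radius `ψ₀` whose distinct points have inner products at most `cos d`. -/
structure IsBaseCode (n : ℕ) (e₀ : Space n) (θ θ₀ : ℝ) (Y : Set (Space n)) : Prop where
  norm_eq : ∀ q ∈ Y, ‖q‖ = 1
  inner_north : ∀ q ∈ Y, inner ℝ (north n) q = 0
  angle_le : ∀ q ∈ Y, angle e₀ q ≤ psi0 θ₀
  inner_le : ∀ q ∈ Y, ∀ r ∈ Y, q ≠ r → inner ℝ q r ≤ Real.cos (dd θ θ₀)

theorem isBaseCode_image_proj (hn : 2 ≤ n) (hθ₀ : π / 3 < θ₀) (hθ₀' : θ₀ < π / 2) (hθ : 0 ≤ θ)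
    (hθ' : θ ≤ θ₀) (he₀ : e₀ ∈ equator n) {X : Set (Space n)}
    (hX : IsKissingIn (Delta n e₀ θ θ₀) X) :
    IsBaseCode n e₀ θ θ₀ (proj '' X) ∧ InjOn proj X := by
  have hp : ∀ x ∈ X, _ := fun x hx => mem_Delta_props hn hθ₀ hθ₀' hθ hθ' he₀ (hX.1 hx)
  have hin : ∀ x ∈ X, ∀ y ∈ X, x ≠ y → inner ℝ (proj x) (proj y) ≤ Real.cos (dd θ θ₀) :=
    fun x hx y hy hxy =>
      inner_proj_le hn hθ₀ hθ₀' hθ hθ' he₀ (hX.1 hx) (hX.1 hy) (hX.2.2 hx hy hxy)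
  refine ⟨⟨?_, ?_, ?_, ?_⟩, ?_⟩
  · rintro _ ⟨x, hx, rfl⟩
    exact (hp x hx).2.2.1
  · rintro _ ⟨x, hx, rfl⟩
    exact (hp x hx).2.2.2.1
  · rintro _ ⟨x, hx, rfl⟩
    exact (hp x hx).2.2.2.2.1
  · rintro _ ⟨x, hx, rfl⟩ _ ⟨y, hy, rfl⟩ hxy
    exact hin x hx y hy fun h => hxy (by rw [h])
  · intro x hx y hy hxy
    by_contra hne
    have h1 := hin x hx y hy hne
    rw [hxy, real_inner_self_eq_norm_sq, (hp y hy).2.2.1] at h1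
    obtain ⟨-, d2, d3, -⟩ := dd_props hθ₀ hθ₀' hθ hθ'
    nlinarith

theorem IsBaseCode.mono {Y Z : Set (Space n)} (hY : IsBaseCode n e₀ θ θ₀ Y) (h : Z ⊆ Y) :
    IsBaseCode n e₀ θ θ₀ Z :=
  ⟨fun q hq => hY.norm_eq q (h hq), fun q hq => hY.inner_north q (h hq),
    fun q hq => hY.angle_le q (h hq), fun q hq r hr => hY.inner_le q (h hq) r (h hr)⟩

theorem isCode_of_inner_le {Y : Set (Space n)} {K : ℝ} (h1 : ∀ q ∈ Y, ‖q‖ = 1)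
    (h : ∀ q ∈ Y, ∀ r ∈ Y, q ≠ r → inner ℝ q r ≤ K) : IsCode (Real.arccos K) Y := by
  refine ⟨fun q hq => by simpa [sph] using h1 q hq, fun q hq r hr hqr => ?_⟩
  change _ ≤ angle q r
  rw [angle_eq_arccos_of_norm_one (h1 q hq) (h1 r hr)]
  exact Real.arccos_le_arccos (h q hq r hr hqr)

/-- The directions at `e₀` of the points of the code. -/
theorem IsBaseCode.directions {Y : Set (Space n)} (hY : IsBaseCode n e₀ θ θ₀ Y)
    (he₀ : e₀ ∈ equator n) {K l u : ℝ} (hK : 0 ≤ K) (hK1 : K < 1) (hl : 0 ≤ l) (hu : u ≤ π / 2)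
    (hYa : ∀ q ∈ Y, angle e₀ q ∈ Icc l u) (hY0 : ∀ q ∈ Y, 0 < angle e₀ q)
    (hll : Real.cos (dd θ θ₀) ≤ Real.cos l * Real.cos l + Real.sin l * Real.sin l * K)
    (hlu : Real.cos (dd θ θ₀) ≤ Real.cos l * Real.cos u + Real.sin l * Real.sin u * K)
    (huu : Real.cos (dd θ θ₀) ≤ Real.cos u * Real.cos u + Real.sin u * Real.sin u * K) :
    InjOn (meridianProj e₀) Y ∧
      (∀ v ∈ meridianProj e₀ '' Y, ‖v‖ = 1 ∧ inner ℝ (north n) v = 0 ∧ inner ℝ e₀ v = 0) ∧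
      ∀ v ∈ meridianProj e₀ '' Y, ∀ w ∈ meridianProj e₀ '' Y, v ≠ w → inner ℝ v w ≤ K := by
  have he1 : ‖e₀‖ = 1 := by simpa [sph] using he₀.1
  have hin : ∀ q ∈ Y, ∀ r ∈ Y, q ≠ r →
      inner ℝ (meridianProj e₀ q) (meridianProj e₀ r) ≤ K := fun q hq r hr hqr =>
    inner_meridianProj_le he1 (hY.norm_eq q hq) (hY.norm_eq r hr) hK hl hu (hYa q hq) (hYa r hr)
      (hY0 q hq) (hY0 r hr) hll hlu huu (hY.inner_le q hq r hr hqr)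
  have hn1 : ∀ q ∈ Y, ‖meridianProj e₀ q‖ = 1 := fun q hq =>
    norm_meridianProj he1 (hY.norm_eq q hq) (Real.sin_pos_of_pos_of_lt_pi (hY0 q hq)
      (by linarith [(hYa q hq).2, Real.pi_pos]))
  refine ⟨fun q hq r hr hqr => ?_, ?_, ?_⟩
  · by_contra hne
    have := hin q hq r hr hne
    rw [hqr, real_inner_self_eq_norm_sq, hn1 r hr] at this
    linarith
  · rintro _ ⟨q, hq, rfl⟩
    exact ⟨hn1 q hq, inner_meridianProj_of_orthogonal he₀.2 (hY.inner_north q hq),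
      inner_meridianProj_self he1 q⟩
  · rintro _ ⟨q, hq, rfl⟩ _ ⟨r, hr, rfl⟩ hqr
    exact hin q hq r hr fun h => hqr (by rw [h])

theorem orthonormal_north (hn : 0 < n) : Orthonormal ℝ ![north n] := by
  rw [orthonormal_iff_ite]
  intro i j
  fin_cases i; fin_cases j
  simp [norm_north hn]

theorem orthonormal_north_equator (he₀ : e₀ ∈ equator n) (hn : 0 < n) :
    Orthonormal ℝ ![north n, e₀] := by
  have he1 : ‖e₀‖ = 1 := by simpa [sph] using he₀.1
  have heN : inner ℝ (north n) e₀ = 0 := he₀.2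
  have heN' := heN
  rw [real_inner_comm] at heN'
  rw [orthonormal_iff_ite]
  intro i j
  fin_cases i <;> fin_cases j <;> simp [norm_north hn, he1, heN, heN']

/-- The space of directions at `e₀` tangent to the equator. -/
noncomputable def directionSpace (n : ℕ) (e₀ : Space n) : Submodule ℝ (Space n) :=
  (Submodule.span ℝ (Set.range ![north n, e₀]))ᗮ

theorem finrank_directionSpace (he₀ : e₀ ∈ equator n) (hn : 0 < n) :
    Module.finrank ℝ (directionSpace n e₀) = n - 2 :=
  finrank_orthogonal_span (orthonormal_north_equator he₀ hn)

theorem mem_directionSpace {v : Space n} (h1 : inner ℝ (north n) v = 0) (h2 : inner ℝ e₀ v = 0) :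
    v ∈ directionSpace n e₀ := by
  refine mem_orthogonal_span_range fun i => ?_
  fin_cases i
  · exact h1
  · exact h2

theorem IsBaseCode.encard_le_capCodeMax (hn : 2 ≤ n) (he₀ : e₀ ∈ equator n) {Y : Set (Space n)}
    (hθ₀ : π / 3 < θ₀) (hθ₀' : θ₀ < π / 2) (hθ : 0 ≤ θ) (hθ' : θ ≤ θ₀)
    (hY : IsBaseCode n e₀ θ θ₀ Y) : Y.encard ≤ capCodeMax (n - 1) (dd θ θ₀) (psi0 θ₀) := by
  have hmem : ∀ q : Space n, inner ℝ (north n) q = 0 →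
      q ∈ (Submodule.span ℝ (Set.range ![north n]))ᗮ := fun q hq =>
    mem_orthogonal_span_range fun i => by fin_cases i; exact hq
  obtain ⟨-, -, -, d4⟩ := dd_props hθ₀ hθ₀' hθ hθ'
  have hcode : IsCode (dd θ θ₀) Y := by
    rw [← Real.arccos_cos d4.1 d4.2]
    exact isCode_of_inner_le hY.norm_eq hY.inner_le
  exact OneSidedKissing.encard_le_capCodeMax _
    (finrank_orthogonal_span (orthonormal_north (by omega))) hcode
    (fun q hq => hmem q (hY.inner_north q hq)) he₀.1 (hmem e₀ he₀.2)
    fun q hq => ⟨hcode.1 hq, hY.angle_le q hq⟩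

/-- For `θ > θ_*`, the angle `ω(d, ψ₀, ψ₀)` lies in `(60°, 90°]` and solves its defining equation. -/
theorem cos_omega_psi0 (hθ₀ : π / 3 < θ₀) (hθ₀' : θ₀ < π / 2) (hθ : 0 ≤ θ) (hθ' : θ ≤ θ₀)
    (h : thetaStar θ₀ < θ) :
    let K := Real.cos (omega (dd θ θ₀) (psi0 θ₀) (psi0 θ₀))
    omega (dd θ θ₀) (psi0 θ₀) (psi0 θ₀) = Real.arccos K ∧ 0 ≤ K ∧ K < 1 / 2 ∧
      Real.cos (dd θ θ₀) = Real.cos (psi0 θ₀) * Real.cos (psi0 θ₀) +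
        Real.sin (psi0 θ₀) * Real.sin (psi0 θ₀) * K := by
  have hpi := Real.pi_pos
  obtain ⟨-, p2, p3, p4, p5⟩ := psi0_props hθ₀ hθ₀'
  obtain ⟨-, d2, d3, -⟩ := dd_props hθ₀ hθ₀' hθ hθ'
  have hd := cos_dd_lt_cos_psi0 hθ₀ hθ₀' hθ' h
  have hs : 0 < Real.sin (psi0 θ₀) := Real.sin_pos_of_pos_of_lt_pi p4 (by linarith)
  have hsc := Real.sin_sq_add_cos_sq (psi0 θ₀)
  have hp : 0 < Real.sin (psi0 θ₀) * Real.sin (psi0 θ₀) := by positivity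
  set c := Real.cos (psi0 θ₀)
  set κ := (Real.cos (dd θ θ₀) - c * c) / (Real.sin (psi0 θ₀) * Real.sin (psi0 θ₀)) with hκ
  -- Here `cos d ≥ 1/2 > 1/3 ≥ c²`. The upper bound comes from `cos d - c² < c(1 - c) ≤ (1 - c²)/2`.
  have hκ0 : 0 ≤ κ := div_nonneg (by nlinarith) hp.le
  have hκ1 : κ < 1 / 2 := by
    rw [hκ, div_lt_iff₀ hp]
    nlinarith
  have hω : Real.cos (omega (dd θ θ₀) (psi0 θ₀) (psi0 θ₀)) = κ :=
    Real.cos_arccos (by linarith) (by linarith)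
  simp only [hω]
  refine ⟨rfl, hκ0, hκ1, ?_⟩
  rw [hκ, mul_div_cancel₀ _ hp.ne']
  ring

/-- No point sits at `e₀`, as a second point would be within `ψ₀ < d` of it; a one-point code could
be `{e₀}`. On the square `[0, ψ₀]²` the corner `(ψ₀, ψ₀)` is the equation of `ω(d, ψ₀, ψ₀)`, and the
other corners use only `cos d ≤ cos ψ₀ ≤ 1`. -/
theorem IsBaseCode.directions_of_nontrivial {Y : Set (Space n)} (hY : IsBaseCode n e₀ θ θ₀ Y)
    (hY2 : Y.Nontrivial) (he₀ : e₀ ∈ equator n) (hθ₀ : π / 3 < θ₀) (hθ₀' : θ₀ < π / 2)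
    (hθ : 0 ≤ θ) (hθ' : θ ≤ θ₀) (h : thetaStar θ₀ < θ) :
    (∀ q ∈ Y, 0 < angle e₀ q) ∧ InjOn (meridianProj e₀) Y ∧
      (∀ v ∈ meridianProj e₀ '' Y, ‖v‖ = 1 ∧ inner ℝ (north n) v = 0 ∧ inner ℝ e₀ v = 0) ∧
      ∀ v ∈ meridianProj e₀ '' Y, ∀ w ∈ meridianProj e₀ '' Y, v ≠ w →
        inner ℝ v w ≤ Real.cos (omega (dd θ θ₀) (psi0 θ₀) (psi0 θ₀)) := by
  have hpi := Real.pi_pos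
  have he1 : ‖e₀‖ = 1 := by simpa [sph] using he₀.1
  obtain ⟨-, hK0, hK1, hK⟩ := cos_omega_psi0 hθ₀ hθ₀' hθ hθ' h
  obtain ⟨-, p2, p3, p4, p5⟩ := psi0_props hθ₀ hθ₀'
  obtain ⟨-, d2, d3, -⟩ := dd_props hθ₀ hθ₀' hθ hθ'
  have hd := cos_dd_lt_cos_psi0 hθ₀ hθ₀' hθ' h
  have h0 : ∀ q ∈ Y, 0 < angle e₀ q := by
    intro q hq
    refine (angle_nonneg _ _).lt_of_ne fun h0 => ?_
    have hqe : q = e₀ := by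
      rw [eq_cos_smul_add_sin_smul he1 (hY.norm_eq q hq), ← h0]
      simp
    obtain ⟨r, hr, hrq⟩ := hY2.exists_ne q
    have h1 := hY.inner_le q hq r hr hrq.symm
    rw [hqe, ← cos_angle_of_norm_one he1 (hY.norm_eq r hr)] at h1
    have h2 := Real.cos_le_cos_of_nonneg_of_le_pi (angle_nonneg _ _) (by linarith)
      (hY.angle_le r hr)
    linarith
  refine ⟨h0, hY.directions he₀ hK0 (by linarith) le_rfl (by linarith)
    (fun q hq => ⟨angle_nonneg _ _, hY.angle_le q hq⟩) h0 ?_ ?_ hK.le⟩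
  · simp [Real.cos_le_one]
  · simp [hd.le]

theorem IsBaseCode.encard_le_codeMax {Y : Set (Space n)} (hY : IsBaseCode n e₀ θ θ₀ Y)
    (hn : 3 ≤ n) (he₀ : e₀ ∈ equator n) (hθ₀ : π / 3 < θ₀) (hθ₀' : θ₀ < π / 2)
    (hθ : 0 ≤ θ) (hθ' : θ ≤ θ₀) (h : thetaStar θ₀ < θ) :
    Y.encard ≤ codeMax (n - 2) (omega (dd θ θ₀) (psi0 θ₀) (psi0 θ₀)) := by
  rcases Y.subsingleton_or_nontrivial with hY1 | hY2
  -- The single point may be `e₀`, which has no direction; any one-point code serves instead, and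
  -- the sphere is nonempty because `n ≥ 3`.
  · refine (Set.encard_le_one_iff_subsingleton.2 hY1).trans ?_
    have hv : IsCode (omega (dd θ θ₀) (psi0 θ₀) (psi0 θ₀)) {north (n - 2)} :=
      ⟨by simp [sph, norm_north (by omega : 0 < n - 2)], Set.pairwise_singleton _ _⟩
    rw [← Set.encard_singleton (north (n - 2))]
    exact le_iSup₂ (f := fun (C : Set (Space (n - 2)))
      (_ : C ∈ {C | IsCode (omega (dd θ θ₀) (psi0 θ₀) (psi0 θ₀)) C}) => C.encard) _ hv
  · obtain ⟨-, hi, h1, h2⟩ := hY.directions_of_nontrivial hY2 he₀ hθ₀ hθ₀' hθ hθ' h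
    rw [← hi.encard_image]
    refine OneSidedKissing.encard_le_codeMax _ (finrank_directionSpace he₀ (by omega)) ?_
      fun v hv => mem_directionSpace (h1 v hv).2.1 (h1 v hv).2.2
    rw [(cos_omega_psi0 hθ₀ hθ₀' hθ hθ' h).1]
    exact isCode_of_inner_le (fun v hv => (h1 v hv).1) h2

/-- In dimension four, at most one point of the code is near the center of the cap, and at most five
directions occur away from it. -/
theorem IsBaseCode.encard_le_six {e₀ : Space 4} {Y : Set (Space 4)} (hY : IsBaseCode 4 e₀ θ θ₀ Y)
    (he₀ : e₀ ∈ equator 4) (hθ₀ : π / 3 < θ₀) (hθ₀' : θ₀ < π / 2)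
    (hθ : 0 ≤ θ) (hθ' : θ ≤ θ₀) : Y.encard ≤ 6 := by
  have hpi := Real.pi_pos
  have he1 : ‖e₀‖ = 1 := by simpa [sph] using he₀.1
  obtain ⟨-, p2, p3, p4, p5⟩ := psi0_props hθ₀ hθ₀'
  obtain ⟨-, d2, d3, -⟩ := dd_props hθ₀ hθ₀' hθ hθ'
  -- `0.58` is just above `1/√3`.
  have hd : Real.cos (dd θ θ₀) < 0.58 := by
    by_contra! h
    nlinarith
  -- The radius `l` comes from the 7-24-25 triangle, so its sine is rational. It must satisfy `cos
  -- 2l > 0.58`, to allow one point in the disc, and also the corner condition at `(l, 60°)` with `K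
  -- = 0.49 < 1/2`.
  set l := Real.arccos (24 / 25) with hl
  have hcl : Real.cos l = 24 / 25 := Real.cos_arccos (by norm_num) (by norm_num)
  have hsl : Real.sin l = 7 / 25 := by
    rw [hl, Real.sin_arccos, Real.sqrt_eq_iff_mul_self_eq (by norm_num) (by norm_num)]
    norm_num
  have hl0 : 0 < l := Real.arccos_pos.2 (by norm_num)
  have hs3 : 1.7 < √3 := Real.lt_sqrt_of_sq_lt (by norm_num)
  have hsq3 : √3 * √3 = 3 := Real.mul_self_sqrt (by norm_num)
  have hnear : {q ∈ Y | angle e₀ q < l}.encard ≤ 1 := by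
    rw [Set.encard_le_one_iff_subsingleton]
    rintro q ⟨hq, hql⟩ r ⟨hr, hrl⟩
    by_contra hqr
    have h1 := hY.inner_le q hq r hr hqr
    have hlp : l ≤ π / 2 := Real.arccos_le_pi_div_two.2 (by norm_num)
    have h2 : Real.cos (l + l) ≤ Real.cos (angle q r) := by
      refine Real.cos_le_cos_of_nonneg_of_le_pi (angle_nonneg _ _) (by linarith) ?_
      have := angle_le_angle_add_angle q e₀ r
      rw [angle_comm q e₀] at this
      linarith
    rw [cos_angle_of_norm_one (hY.norm_eq q hq) (hY.norm_eq r hr), Real.cos_add, hcl, hsl] at h2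
    norm_num at h2
    linarith
  have hfar : {q ∈ Y | l ≤ angle e₀ q}.encard ≤ 5 := by
    obtain ⟨hi, h1, h2⟩ := (hY.mono (Set.sep_subset Y fun q => l ≤ angle e₀ q)).directions he₀
      (K := 0.49) (l := l) (u := π / 3) (by norm_num) (by norm_num) hl0.le (by linarith)
      (fun q hq => ⟨hq.2, (hY.angle_le q hq.1).trans p5.le⟩) (fun q hq => hl0.trans_le hq.2)
      (by rw [hcl, hsl]; linarith)
      (by rw [hcl, hsl, Real.cos_pi_div_three, Real.sin_pi_div_three]; linarith)
      (by rw [Real.cos_pi_div_three, Real.sin_pi_div_three]; linarith)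
    rw [← hi.encard_image]
    exact card_le_five (directionSpace 4 e₀) (finrank_directionSpace he₀ (by norm_num)) (K := 0.49)
      (by norm_num) (by norm_num)
      (fun v hv => ⟨mem_directionSpace (h1 v hv).2.1 (h1 v hv).2.2, (h1 v hv).1⟩) h2
  have hunion : Y = {q ∈ Y | angle e₀ q < l} ∪ {q ∈ Y | l ≤ angle e₀ q} := by
    ext q
    simp only [mem_union, mem_ofPred_eq, ← and_or_left, lt_or_ge, and_true]
  rw [hunion]
  calc _ ≤ _ := Set.encard_union_le _ _
    _ ≤ 1 + 5 := add_le_add hnear hfar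
    _ = 6 := by norm_num

theorem IsBaseCode.encard_le_five {e₀ : Space 4} {Y : Set (Space 4)} (hY : IsBaseCode 4 e₀ θ θ₀ Y)
    (he₀ : e₀ ∈ equator 4) (hθ₀ : π / 3 < θ₀) (hθ₀' : θ₀ < π / 2)
    (hθ : 0 ≤ θ) (hθ' : θ ≤ θ₀) (h : thetaStar θ₀ < θ) : Y.encard ≤ 5 := by
  rcases Y.subsingleton_or_nontrivial with hY1 | hY2
  · exact (Set.encard_le_one_iff_subsingleton.2 hY1).trans (by norm_num)
  · obtain ⟨-, hi, h1, h2⟩ := hY.directions_of_nontrivial hY2 he₀ hθ₀ hθ₀' hθ hθ' h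
    obtain ⟨-, hK0, hK1, -⟩ := cos_omega_psi0 hθ₀ hθ₀' hθ hθ' h
    rw [← hi.encard_image]
    exact card_le_five (directionSpace 4 e₀) (finrank_directionSpace he₀ (by norm_num)) hK0 hK1
      (fun v hv => ⟨mem_directionSpace (h1 v hv).2.1 (h1 v hv).2.2, (h1 v hv).1⟩) h2

/-- In a code of five points, every point has a neighbor whose direction differs by at most `η`. -/
theorem IsBaseCode.exists_neighbor {e₀ : Space 4} {Y : Set (Space 4)}
    (hY : IsBaseCode 4 e₀ θ θ₀ Y) (he₀ : e₀ ∈ equator 4) (hθ₀ : π / 3 < θ₀) (hθ₀' : θ₀ < π / 2)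
    (hθ : 0 ≤ θ) (hθ' : θ ≤ θ₀) (h : thetaStar θ₀ < θ) (hY5 : Y.encard = 5) {q : Space 4}
    (hq : q ∈ Y) :
    ∃ r ∈ Y, r ≠ q ∧
      Real.cos (eta θ θ₀) ≤ inner ℝ (meridianProj e₀ q) (meridianProj e₀ r) := by
  classical
  have hpi := Real.pi_pos
  obtain ⟨hω, hK0, hK1, -⟩ := cos_omega_psi0 hθ₀ hθ₀' hθ hθ' h
  have hY2 : Y.Nontrivial := by
    rw [← Set.one_lt_encard_iff_nontrivial, hY5]
    norm_num
  obtain ⟨h0, hi, h1, h2⟩ := hY.directions_of_nontrivial hY2 he₀ hθ₀ hθ₀' hθ hθ' h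
  set ω := omega (dd θ θ₀) (psi0 θ₀) (psi0 θ₀) with hωdef
  have hω0 : 0 < ω := by
    rw [hω]
    exact Real.arccos_pos.2 (by linarith)
  have hω2 : ω ≤ π / 2 := by
    rw [hω]
    exact Real.arccos_le_pi_div_two.2 hK0
  have heta : eta θ θ₀ = π - 3 * ω / 2 := rfl
  by_contra! hcon
  obtain ⟨s, hs⟩ : ∃ s : Finset (Space 4), (s : Set (Space 4)) = Y :=
    (Set.finite_of_encard_eq_coe (k := 5) (by simpa using hY5)).exists_finset_coe
  have hs5 : s.card = 5 := by
    rw [← hs, Set.encard_coe_eq_coe_finsetCard] at hY5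
    exact_mod_cast hY5
  have hqs : q ∈ s := by rw [← Finset.mem_coe, hs]; exact hq
  have hsY : ∀ r ∈ s, r ∈ Y := fun r hr => by rw [← hs]; exact hr
  have hd : ∀ r ∈ s, meridianProj e₀ r ∈ directionSpace 4 e₀ ∧ ‖meridianProj e₀ r‖ = 1 :=
    fun r hr =>
      have := h1 _ (Set.mem_image_of_mem _ (hsY r hr))
      ⟨mem_directionSpace this.2.1 this.2.2, this.1⟩
  -- Otherwise the other four directions would lie on an arc of length `2(π - η) = 3ω`, which holds
  -- at most three.
  have := card_le_of_far (directionSpace 4 e₀) (finrank_directionSpace he₀ (by norm_num))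
    (hd q hqs).1 (hd q hqs).2 (s := (s.erase q).image (meridianProj e₀)) (ω := ω)
    (β := eta θ θ₀) (k := 3) hω0 (by linarith) (by rw [heta]; linarith)
    (by rw [heta]; push_cast; linarith)
    (by
      intro v hv
      obtain ⟨r, hr, rfl⟩ := Finset.mem_image.1 hv
      exact hd r (Finset.mem_of_mem_erase hr))
    (by
      intro v hv
      obtain ⟨r, hr, rfl⟩ := Finset.mem_image.1 hv
      exact hcon r (hsY r (Finset.mem_of_mem_erase hr)) (Finset.ne_of_mem_erase hr))
    (by
      intro v hv w hw hvw
      obtain ⟨r, hr, rfl⟩ := Finset.mem_image.1 hv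
      obtain ⟨t, ht, rfl⟩ := Finset.mem_image.1 hw
      exact h2 _ (Set.mem_image_of_mem _ (hsY r (Finset.mem_of_mem_erase hr))) _
        (Set.mem_image_of_mem _ (hsY t (Finset.mem_of_mem_erase ht))) hvw)
  rw [Finset.card_image_of_injOn, Finset.card_erase_of_mem hqs] at this
  · omega
  · exact hi.mono fun r hr => hsY r (Finset.mem_of_mem_erase hr)

/-- If `q` were closer to `e₀` than `ρ₅`, take its neighbor `r` with direction within `η`. As a
function of the distance of `r` from `e₀`, the law of cosines with angle `η` is concave and exceeds
`cos d` at `0` (as `ψ₀ < d`) and at `ψ₀` (by the choice of `ρ₅`), so `r` would be closer than `d` to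
`q`. -/
theorem IsBaseCode.rho5_le {e₀ : Space 4} {Y : Set (Space 4)}
    (hY : IsBaseCode 4 e₀ θ θ₀ Y) (he₀ : e₀ ∈ equator 4) (hθ₀ : π / 3 < θ₀) (hθ₀' : θ₀ < π / 2)
    (hθ : 0 ≤ θ) (hθ' : θ ≤ θ₀) (h : thetaStar θ₀ < θ) (hY5 : Y.encard = 5) :
    (∃! x, x ∈ Icc 0 (psi0 θ₀) ∧ IsSide (psi0 θ₀) (dd θ θ₀) (eta θ θ₀) x) ∧
      ∀ q ∈ Y, rho5 θ θ₀ ≤ angle e₀ q := by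
  have hpi := Real.pi_pos
  have he1 : ‖e₀‖ = 1 := by simpa [sph] using he₀.1
  obtain ⟨hω, hK0, hK1, hK⟩ := cos_omega_psi0 hθ₀ hθ₀' hθ hθ' h
  obtain ⟨-, p2, p3, p4, p5⟩ := psi0_props hθ₀ hθ₀'
  have hd := cos_dd_lt_cos_psi0 hθ₀ hθ₀' hθ' h
  have hnb := fun q hq => hY.exists_neighbor he₀ hθ₀ hθ₀' hθ hθ' h hY5 (q := q) hq
  have hY2 : Y.Nontrivial := by
    rw [← Set.one_lt_encard_iff_nontrivial, hY5]
    norm_num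
  obtain ⟨h0, hi, -, h2⟩ := hY.directions_of_nontrivial hY2 he₀ hθ₀ hθ₀' hθ hθ' h
  have hω3 : π / 3 < omega (dd θ θ₀) (psi0 θ₀) (psi0 θ₀) := by
    by_contra! hle
    have := Real.cos_le_cos_of_nonneg_of_le_pi (Real.arccos_nonneg _) (by linarith) hle
    rw [Real.cos_pi_div_three] at this
    exact absurd this (not_le.2 hK1)
  have hω2 : omega (dd θ θ₀) (psi0 θ₀) (psi0 θ₀) ≤ π / 2 := by
    rw [hω]
    exact Real.arccos_le_pi_div_two.2 hK0
  set ω := omega (dd θ θ₀) (psi0 θ₀) (psi0 θ₀) with hωdef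
  have heta : eta θ θ₀ = π - 3 * ω / 2 := rfl
  -- From `60° < ω ≤ 90°` follows `45° ≤ η < 90°`; the concavity below needs this sign.
  have hη0 : 0 ≤ Real.cos (eta θ θ₀) :=
    Real.cos_nonneg_of_mem_Icc ⟨by linarith, by linarith⟩
  -- Here the five points give `η ≥ ω`: some pair of directions is at most `η` and at least `ω`
  -- apart. This makes `f (psi0 θ₀) ≤ cos d`, hence the root exists.
  have hηω : Real.cos (eta θ θ₀) ≤ Real.cos ω := by
    obtain ⟨q, hq⟩ := hY2.nonempty
    obtain ⟨r, hr, hrq, hle⟩ := hnb q hq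
    exact hle.trans (h2 _ (Set.mem_image_of_mem _ hq) _ (Set.mem_image_of_mem _ hr)
      fun heq => hrq (hi hq hr heq).symm)
  set f : ℝ → ℝ := fun x => Real.cos (psi0 θ₀) * Real.cos x +
    Real.sin (psi0 θ₀) * Real.cos (eta θ θ₀) * Real.sin x with hf
  have hfc : ConcaveOn ℝ (Icc 0 (π / 2)) f := concaveOn_side p4.le (by linarith) hη0
  have hf0 : Real.cos (dd θ θ₀) < f 0 := by simpa [hf] using hd
  have hs0 : 0 < Real.sin (psi0 θ₀) := Real.sin_pos_of_pos_of_lt_pi p4 (by linarith)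
  have hfψ : f (psi0 θ₀) ≤ Real.cos (dd θ θ₀) := by
    have := mul_le_mul_of_nonneg_left hηω (mul_pos hs0 hs0).le
    simp only [hf]
    linarith
  have hside : ∀ x, IsSide (psi0 θ₀) (dd θ θ₀) (eta θ θ₀) x ↔ f x = Real.cos (dd θ θ₀) := by
    intro x
    rw [IsSide, hf]
    constructor <;> intro h <;> simp only at h ⊢ <;> linarith
  have hcont : ContinuousOn f (Icc 0 (psi0 θ₀)) := by
    apply Continuous.continuousOn
    fun_prop
  obtain ⟨x, hx, hfx⟩ := intermediate_value_Icc' p4.le hcont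
    (show Real.cos (dd θ θ₀) ∈ Icc (f (psi0 θ₀)) (f 0) from ⟨hfψ, hf0.le⟩)
  have hlt : ∀ a b, 0 ≤ a → a < b → b ≤ psi0 θ₀ → f b = Real.cos (dd θ θ₀) →
      Real.cos (dd θ θ₀) < f a := fun a b ha hab hb hfb =>
    lt_of_mem_Ico_of_concaveOn hfc (a := 0) (b := b) (x := a) ⟨le_rfl, by linarith⟩
      ⟨by linarith, by linarith⟩ ⟨ha, hab⟩ hf0 hfb.ge
  have hex : ∃! x, x ∈ Icc 0 (psi0 θ₀) ∧ IsSide (psi0 θ₀) (dd θ θ₀) (eta θ θ₀) x := by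
    refine ⟨x, ⟨hx, (hside x).2 hfx⟩, ?_⟩
    rintro y ⟨hy, hfy⟩
    rw [hside] at hfy
    rcases lt_trichotomy x y with hxy | hxy | hxy
    · exact absurd hfx (hlt x y hx.1 hxy hy.2 hfy).ne'
    · exact hxy.symm
    · exact absurd hfy (hlt y x hy.1 hxy hx.2 hfx).ne'
  refine ⟨hex, fun q hq => ?_⟩
  have hrho : rho5 θ θ₀ = x := csInf_eq_of_existsUnique hex ⟨hx, (hside x).2 hfx⟩
  rw [hrho]
  by_contra! hqx
  obtain ⟨r, hr, hrq, hle⟩ := hnb q hq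
  have h3 := hY.inner_le q hq r hr hrq.symm
  rw [inner_eq_cos_mul_cos_add he1 (hY.norm_eq q hq) (hY.norm_eq r hr)] at h3
  have hq0 := h0 q hq
  have hqψ := hY.angle_le q hq
  have hr0 := h0 r hr
  have hrψ := hY.angle_le r hr
  have hsq : 0 < Real.sin (angle e₀ q) := Real.sin_pos_of_pos_of_lt_pi hq0 (by linarith)
  have hsr : 0 < Real.sin (angle e₀ r) := Real.sin_pos_of_pos_of_lt_pi hr0 (by linarith)
  have h4 := mul_le_mul_of_nonneg_left hle (mul_pos hsq hsr).le
  have h5 := hlt (angle e₀ q) x hq0.le hqx hx.2 hfx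
  have h6 : Real.cos (dd θ θ₀) < Real.cos (angle e₀ q) := hd.trans_le
    (Real.cos_le_cos_of_nonneg_of_le_pi hq0.le (by linarith) hqψ)
  have hg := concaveOn_side (θ := angle e₀ q) (k := Real.cos (eta θ θ₀)) hq0.le (by linarith) hη0
  have h7 : Real.cos (dd θ θ₀) < Real.cos (angle e₀ q) * Real.cos (psi0 θ₀) +
      Real.sin (angle e₀ q) * Real.cos (eta θ θ₀) * Real.sin (psi0 θ₀) := by
    simp only [hf] at h5
    linarith
  have h8 := lt_of_mem_Ioc_of_concaveOn hg (a := 0) (b := psi0 θ₀) (x := angle e₀ r)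
    (c := Real.cos (dd θ θ₀)) ⟨le_rfl, by linarith⟩ ⟨p4.le, by linarith⟩ ⟨hr0, hrψ⟩
    (by simpa using h6.le) h7
  linarith

end CapCode

end OneSidedKissing

theorem theorem6 (n : ℕ) (hn : 2 ≤ n) (θ θ₀ : ℝ) (hθ₀ : π / 3 < θ₀) (hθ₀' : θ₀ < π / 2)
    (hθ : 0 ≤ θ) (hθ' : θ ≤ θ₀) (e₀ : Space n) (he₀ : e₀ ∈ equator n)
    (m : ℕ) (p : Fin m → Space n) (hp : Function.Injective p)
    (hX : IsKissingIn (Delta n e₀ θ θ₀) (Set.range p)) :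
    -- the equations that define `γ(θ, θ₀)` and `θ_*(θ₀)` have exactly one solution
    ((∃! x, x ∈ Set.Icc θ π ∧ IsSide θ (π / 3) (psi0 θ₀) x) ∧
      (∃! t, t ∈ Set.Icc 0 θ₀ ∧ dd t θ₀ = psi0 θ₀)) ∧
    -- 1)
    ((∀ i j, i ≠ j → dd θ θ₀ ≤ InnerProductGeometry.angle (proj (p i)) (proj (p j))) ∧
      (π / 6 < θ → ∀ i, rho θ ≤ InnerProductGeometry.angle e₀ (proj (p i)))) ∧
    -- 2)
    ((m : ℕ∞) ≤ mu n e₀ θ θ₀ ∧ mu n e₀ θ θ₀ ≤ capCodeMax (n - 1) (dd θ θ₀) (psi0 θ₀)) ∧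
    -- 3)
    (3 ≤ n → thetaStar θ₀ < θ →
      (m : ℕ∞) ≤ mu n e₀ θ θ₀ ∧
      mu n e₀ θ θ₀ ≤ codeMax (n - 2) (omega (dd θ θ₀) (psi0 θ₀) (psi0 θ₀))) ∧
    -- 4)
    (n = 4 →
      ((m : ℕ∞) ≤ mu n e₀ θ θ₀ ∧ mu n e₀ θ θ₀ ≤ 6) ∧
      (thetaStar θ₀ < θ →
        m ≤ 5 ∧
        (m = 5 →
          (∃! x, x ∈ Set.Icc 0 (psi0 θ₀) ∧ IsSide (psi0 θ₀) (dd θ θ₀) (eta θ θ₀) x) ∧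
          ∀ i, rho5 θ θ₀ ≤ InnerProductGeometry.angle e₀ (proj (p i))))) := by
  have hXm : (Set.range p).encard = m := by
    rw [← Set.image_univ, hp.encard_image, Set.encard_univ, ENat.card_eq_coe_fintype_card,
      Fintype.card_fin]
  have hmu : (m : ℕ∞) ≤ mu n e₀ θ θ₀ := by
    rw [← hXm]
    exact le_iSup₂ (f := fun (X : Set (Space n))
      (_ : X ∈ {X | IsKissingIn (Delta n e₀ θ θ₀) X}) => X.encard) _ hX
  -- Every upper bound on `μ` reduces to one on codes in the equatorial cap, as `proj` is injective
  -- on kissing arrangements in `Δ`.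
  have mu_le : ∀ b : ℕ∞, (∀ Y, IsBaseCode n e₀ θ θ₀ Y → Y.encard ≤ b) → mu n e₀ θ θ₀ ≤ b := by
    intro b hb
    refine iSup₂_le fun X hX => ?_
    obtain ⟨hY, hi⟩ := isBaseCode_image_proj hn hθ₀ hθ₀' hθ hθ' he₀ hX
    rw [← hi.encard_image]
    exact hb _ hY
  obtain ⟨hY, hi⟩ := isBaseCode_image_proj hn hθ₀ hθ₀' hθ hθ' he₀ hX
  have hYm : (proj '' Set.range p).encard = m := by rw [hi.encard_image, hXm]
  refine ⟨⟨existsUnique_gamma hθ₀ hθ₀' hθ hθ', existsUnique_thetaStar hθ₀ hθ₀'⟩, ⟨?_, ?_⟩,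
    ⟨hmu, mu_le _ fun Y hY => hY.encard_le_capCodeMax hn he₀ hθ₀ hθ₀' hθ hθ'⟩,
    fun hn3 h => ⟨hmu, mu_le _ fun Y hY => hY.encard_le_codeMax hn3 he₀ hθ₀ hθ₀' hθ hθ' h⟩, ?_⟩
  · intro i j hij
    have h1 := hY.inner_le _ ⟨p i, ⟨i, rfl⟩, rfl⟩ _ ⟨p j, ⟨j, rfl⟩, rfl⟩
      fun h => hij (hp (hi ⟨i, rfl⟩ ⟨j, rfl⟩ h))
    have hd := (dd_props hθ₀ hθ₀' hθ hθ').2.2.2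
    rw [InnerProductGeometry.angle,
      hY.norm_eq _ ⟨p i, ⟨i, rfl⟩, rfl⟩, hY.norm_eq _ ⟨p j, ⟨j, rfl⟩, rfl⟩, mul_one, div_one,
      ← Real.arccos_cos hd.1 hd.2]
    exact Real.arccos_le_arccos h1
  · exact fun h6 i => rho_le_angle hn hθ₀ hθ₀' h6 hθ' he₀ (hX.1 ⟨i, rfl⟩)
  · rintro rfl
    refine ⟨⟨hmu, mu_le _ fun Y hY => hY.encard_le_six he₀ hθ₀ hθ₀' hθ hθ'⟩, fun h => ⟨?_, ?_⟩⟩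
    · have := hY.encard_le_five he₀ hθ₀ hθ₀' hθ hθ' h
      rw [hYm] at this
      exact_mod_cast this
    · rintro rfl
      obtain ⟨hex, hrho⟩ := hY.rho5_le he₀ hθ₀ hθ₀' hθ hθ' h (by rw [hYm]; norm_num)
      exact ⟨hex, fun i => hrho _ ⟨p i, ⟨i, rfl⟩, rfl⟩⟩
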